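/- **Model.** Let $N,p,m,q\ge 0$ be integers and $d=p+2(m+2)$. Write $\eta=(\beta,u_\alpha,u_{\mathcal B})\in\mathbb R^{p}\times\mathbb R^{m+2}\times\mathbb R^{m+2}=\mathbb R^{d}$. Let $M\in\mathbb R^{N\times d}$ have rows $m_i^\top$, let $y\in\mathbb R^N$, $\mu\in\mathbb R^p$, let $\Sigma\in\mathbb R^{p\times p}$ be symmetric positive definite, $R\in\mathbb R^{q\times p}$, $c\in\mathbb R^q$, and let $a_0,b_0,\tau_0>0$. Let $\xi_1,\dots,\xi_N:\mathbb R\to\mathbb R$ be convex with $\xi_i(m_i^\top\eta)\ge 0$ for all $i$ and all $\eta\in\mathbb R^d$ (in a GLM all $\xi_i$ are equal). Assume that $\{\beta\in\mathbb R^p: R\beta\ge c\}$ has positive Lebesgue measure, and put $\mathcal C=\{\eta: R\beta\ge c,\ u_\alpha\ge 0\}$. For $\tau=(\tau_\alpha,\tau_{\mathcal B})$ let $A(\tau)=\Sigma^{-1}\oplus\tau_\alpha I_{m+2}\oplus\tau_{\mathcal B}I_{m+2}$ and $b=(\mu,0,0)$. Let $\mathrm{TN}(a,V,S)$ denote the normal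 law with mean $a$ and covariance $V$ conditioned to lie in $S$, and let $\mathrm{TG}(a,b,\tau_0)$ denote the law on $[\tau_0,\infty)$ with density proportional to $t^{a-1}e^{-bt}$. The likelihood is $L(\eta)=\exp(y^\top M\eta-\sum_{i}\xi_i(m_i^\top\eta))$, the priors are $\eta\mid\tau\sim\mathrm{TN}(b,A(\tau)^{-1},\mathcal C)$ and, independently, $\tau_\alpha,\tau_{\mathcal B}\sim\mathrm{TG}(a_0,b_0,\tau_0)$, and $\Pi(\cdot\mid y)$ denotes the marginal posterior law of $\eta$. **Sampler.** From the current state $\eta'=(\beta',u'_\alpha,u'_{\mathcal B})\in\mathcal C$ draw, independently, $\omega_i\sim\mathrm U(0,e^{-\xi_i(m_i^\top\eta')})$ for $1\le i\le N$ and $\tau_j\sim\mathrm{TG}\big(a_0+\tfrac{m+2}{2},\,b_0+\tfrac12 u_j'^{\top}u_j',\,\tau_0\big)$ for $j\in\{\alpha,\mathcal B\}$. Then draw the next state $$\eta\sim\mathrm{TN}\big(A(\tau)^{-1}\mu_*,\,A(\tau)^{-1},\,\{\eta\in\mathcal C:\ \omega_i\le e^{-\xi_i(m_i^\top\eta)}\text{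 for all }i\}\big),\qquad \mu_*=M^\top y+A(\tau)b.$$ Let $k(\eta\mid\eta')$ be the resulting transition density of the $\eta$-marginal chain (the integral over $(\omega,\tau)$ of the density of $\eta$ given $(\omega,\tau)$ times the density of $(\omega,\tau)$ given $\eta'$), let $K(\eta',A)=\int_A k(\eta\mid\eta')\,d\eta$, and let $K^n$ be its $n$-step transition probabilities. **Theorem.** $\Pi(\cdot\mid y)$ is a well-defined probability measure, and $K$ is a Markov transition function on $\mathcal C$. There are $\delta>0$ and a probability density $h$ on $\mathbb R^d$ with $k(\eta\mid\eta')\ge\delta h(\eta)$ for all $\eta'\in\mathcal C$ and $\eta\in\mathbb R^d$. The chain is uniformly ergodic: there are $V<\infty$ and $r\in(0,1)$ such that for all $\eta\in\mathcal C$ and all $n\ge 0$ $$\sup_{A}\big|K^n(\eta,A)-\Pi(A\mid y)\big|\le V r^n ,$$ where the supremum is over the Borel sets $A\subseteq\mathbb R^{d}$. -/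

import Mathlib

open MeasureTheory
open scoped ENNReal Matrix

namespace SliceGibbs

/-- Indices of the coefficient vector `η = (β, u_α, u_B)`: `p` fixed effects and two blocks of
`m + 2` spline (random) effects. -/
abbrev Idx (p m : ℕ) : Type := Fin p ⊕ (Fin (m + 2) ⊕ Fin (m + 2))

/-- Coefficient vectors `η`, a copy of `ℝ^(p + 2m + 4)` with its Borel sets and Lebesgue measure. -/
abbrev Coef (p m : ℕ) : Type := Idx p m → ℝ

/-- The block `β` of fixed effects. -/
def Coef.beta {p m : ℕ} (η : Coef p m) : Fin p → ℝ := fun i => η (Sum.inl i)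

/-- The block `u_α` (coefficients of the monotone component). -/
def Coef.uA {p m : ℕ} (η : Coef p m) : Fin (m + 2) → ℝ := fun i => η (Sum.inr (Sum.inl i))

/-- The block `u_B` (coefficients of the smooth component). -/
def Coef.uB {p m : ℕ} (η : Coef p m) : Fin (m + 2) → ℝ := fun i => η (Sum.inr (Sum.inr i))

/-! ### Truncated gamma and truncated normal densities -/

/-- The normalizing constant `∫_{τ₀}^∞ t^(a-1) e^(-bt) dt` of the truncated gamma law. -/
noncomputable def truncGammaConst (a b τ₀ : ℝ) : ℝ≥0∞ :=
  ∫⁻ t in Set.Ici τ₀, ENNReal.ofReal (t ^ (a - 1) * Real.exp (-b * t))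

/-- Density of the gamma law with shape `a` and rate `b` truncated below at `τ₀`. -/
noncomputable def truncGammaPDF (a b τ₀ t : ℝ) : ℝ≥0∞ :=
  (Set.Ici τ₀).indicator
    (fun t => ENNReal.ofReal (t ^ (a - 1) * Real.exp (-b * t)) / truncGammaConst a b τ₀) t

/-- The Gaussian kernel `exp(-½ (x - a)ᵀ Q (x - a))` with mean `a` and precision matrix `Q`. -/
noncomputable def gaussKernel {ι : Type} [Fintype ι] (a : ι → ℝ) (Q : Matrix ι ι ℝ)
    (x : ι → ℝ) : ℝ≥0∞ :=
  ENNReal.ofReal (Real.exp (-(1 / 2) * ((x - a) ⬝ᵥ (Q *ᵥ (x - a)))))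

/-- Density of the normal law with mean `a` and precision (inverse covariance) matrix `Q`
truncated to the set `S`. -/
noncomputable def truncNormalPDF {ι : Type} [Fintype ι] (a : ι → ℝ) (Q : Matrix ι ι ℝ)
    (S : Set (ι → ℝ)) (x : ι → ℝ) : ℝ≥0∞ :=
  S.indicator (fun x => gaussKernel a Q x / ∫⁻ z in S, gaussKernel a Q z) x

/-! ### The model -/

/-- The data of a linearly constrained Bayesian GLMM / GAM with `N` observations. -/
structure Model (N p m q : ℕ) where
  /-- The design matrix, with rows `m_iᵀ`. -/
  design : Matrix (Fin N) (Idx p m) ℝ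
  /-- The responses. -/
  y : Fin N → ℝ
  /-- The functions `ξ_i`; they are all equal in a GLM, and `ξ_i(v) = exp(log t_i + v)` in the
  exponential proportional hazards model. -/
  ξ : Fin N → ℝ → ℝ
  /-- The prior mean of `β`. -/
  mu : Fin p → ℝ
  /-- The prior covariance matrix of `β`. -/
  cov : Matrix (Fin p) (Fin p) ℝ
  /-- The matrix of the linear constraints `R β ≥ c` on the fixed effects. -/
  R : Matrix (Fin q) (Fin p) ℝ
  /-- The right-hand side of the linear constraints `R β ≥ c` on the fixed effects. -/
  c : Fin q → ℝ
  /-- The shape of the truncated gamma priors. -/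
  a₀ : ℝ
  /-- The rate of the truncated gamma priors. -/
  b₀ : ℝ
  /-- The truncation point of the truncated gamma priors. -/
  τ₀ : ℝ

namespace Model

variable {N p m q : ℕ} (D : Model N p m q)

/-- The fixed effects that satisfy the linear constraints. -/
def feasibleBeta : Set (Fin p → ℝ) := {β | ∀ j, D.c j ≤ (D.R *ᵥ β) j}

/-- The constraint set of `η`: `R β ≥ c` and `u_α ≥ 0`. -/
def feasible : Set (Coef p m) := {η | η.beta ∈ D.feasibleBeta ∧ ∀ l, 0 ≤ η.uA l}

/-- The linear predictor `m_iᵀ η`. -/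
def linPred (i : Fin N) (η : Coef p m) : ℝ := D.design i ⬝ᵥ η

/-- The slice height `exp(-ξ_i(m_iᵀ η))`. -/
noncomputable def height (i : Fin N) (η : Coef p m) : ℝ := Real.exp (-D.ξ i (D.linPred i η))

/-- The likelihood `exp(yᵀ M η) exp(-∑ ξ_i(m_iᵀ η))`. -/
noncomputable def likelihood (η : Coef p m) : ℝ≥0∞ :=
  ENNReal.ofReal
    (Real.exp (D.y ⬝ᵥ (D.design *ᵥ η)) * Real.exp (-∑ i, D.ξ i (D.linPred i η)))

/-- The prior precision `A(τ) = Σ⁻¹ ⊕ τ_α I ⊕ τ_B I`, where `τ = (τ_α, τ_B)`. -/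
noncomputable def precision (τ : ℝ × ℝ) : Matrix (Idx p m) (Idx p m) ℝ :=
  Matrix.fromBlocks D.cov⁻¹ 0 0 (Matrix.fromBlocks (τ.1 • 1) 0 0 (τ.2 • 1))

/-- The prior mean `b = (μ, 0, 0)`. -/
def priorMean : Coef p m := Sum.elim D.mu 0

/-! ### The posterior law of `η` -/

/-- Likelihood times the truncated normal prior of `η` given `τ` times the truncated gamma priors
of `τ_α` and `τ_B`. -/
noncomputable def jointWeight (η : Coef p m) (τ : ℝ × ℝ) : ℝ≥0∞ :=
  D.likelihood η * truncNormalPDF D.priorMean (D.precision τ) D.feasible η *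
    (truncGammaPDF D.a₀ D.b₀ D.τ₀ τ.1 * truncGammaPDF D.a₀ D.b₀ D.τ₀ τ.2)

/-- The unnormalized marginal posterior density of `η`. -/
noncomputable def marginalWeight (η : Coef p m) : ℝ≥0∞ := ∫⁻ τ, D.jointWeight η τ

/-- The marginal posterior law of `η` given `y`. -/
noncomputable def posterior : Measure (Coef p m) :=
  volume.withDensity fun η => D.marginalWeight η / ∫⁻ z, D.marginalWeight z

/-! ### The block slice / Gibbs sampler -/

/-- The set that `η` is restricted to, given the slice variables. -/
def sliceSet (ω : Fin N → ℝ) : Set (Coef p m) :=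
  {η | η ∈ D.feasible ∧ ∀ i, ω i ≤ D.height i η}

/-- `μ_* = Mᵀ y + A(τ) b`. -/
noncomputable def muStar (τ : ℝ × ℝ) : Coef p m :=
  D.designᵀ *ᵥ D.y + D.precision τ *ᵥ D.priorMean

/-- The density of the update of `η` given `ω` and `τ`: a truncated normal law with mean
`A(τ)⁻¹ μ_*` and covariance `A(τ)⁻¹`. -/
noncomputable def etaPDF (ω : Fin N → ℝ) (τ : ℝ × ℝ) (η : Coef p m) : ℝ≥0∞ :=
  truncNormalPDF ((D.precision τ)⁻¹ *ᵥ D.muStar τ) (D.precision τ) (D.sliceSet ω) η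

/-- The density of the update of `ω` given `η`: independent uniform laws on `[0, height i η]`. -/
noncomputable def omegaPDF (η : Coef p m) (ω : Fin N → ℝ) : ℝ≥0∞ :=
  ∏ i, (Set.Icc 0 (D.height i η)).indicator (fun _ => (ENNReal.ofReal (D.height i η))⁻¹) (ω i)

/-- The density of the update of `τ` given `η`: independent truncated gamma laws with shape
`a₀ + (m + 2) / 2` and rates `b₀ + |u_j|² / 2`. -/
noncomputable def tauPDF (η : Coef p m) (τ : ℝ × ℝ) : ℝ≥0∞ :=
  truncGammaPDF (D.a₀ + ((m : ℝ) + 2) / 2) (D.b₀ + (η.uA ⬝ᵥ η.uA) / 2) D.τ₀ τ.1 *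
    truncGammaPDF (D.a₀ + ((m : ℝ) + 2) / 2) (D.b₀ + (η.uB ⬝ᵥ η.uB) / 2) D.τ₀ τ.2

/-- The Markov transition density `k(η | η')` of the `η`-marginal chain; the current state is
`η'`, the next one `η`. -/
noncomputable def transDensity (η' η : Coef p m) : ℝ≥0∞ :=
  ∫⁻ τ : ℝ × ℝ, ∫⁻ ω : Fin N → ℝ, D.etaPDF ω τ η * (D.omegaPDF η' ω * D.tauPDF η' τ)

/-- The Markov transition function `K(η', A) = ∫_A k(η | η') dη`. -/
noncomputable def trans (η' : Coef p m) : Measure (Coef p m) :=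
  volume.withDensity (D.transDensity η')

end Model

/-! ### Uniform ergodicity -/

/-- The `n`-step transition probabilities `Kⁿ(x, A)` of a Markov transition function `K`. -/
noncomputable def stepProb {E : Type} [MeasurableSpace E] (K : E → Measure E) :
    ℕ → E → Set E → ℝ≥0∞
  | 0, x, A => Measure.dirac x A
  | n + 1, x, A => ∫⁻ z, stepProb K n z A ∂(K x)

/-- `K` maps every state of `S` to a probability measure carried by `S`. -/
def IsMarkovOn {E : Type} [MeasurableSpace E] (S : Set E) (K : E → Measure E) : Prop :=
  ∀ x ∈ S, IsProbabilityMeasure (K x) ∧ K x Sᶜ = 0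

/-- Uniform ergodicity on the state space `S` with limit law `P`: the total variation distance
`sup_A |Kⁿ(x, A) - P(A)|` is at most `V rⁿ`, with `V < ∞` and `r < 1` independent of `x` and `n`. -/
def IsUniformlyErgodic {E : Type} [MeasurableSpace E] (S : Set E) (K : E → Measure E)
    (P : Measure E) : Prop :=
  ∃ V r : ℝ, 0 < r ∧ r < 1 ∧ ∀ x ∈ S, ∀ n : ℕ, ∀ A : Set E, MeasurableSet A →
    |(stepProb K n x A).toReal - (P A).toReal| ≤ V * r ^ n

end SliceGibbs

/-!
The sampler is a data augmentation chain, and two facts about it give the theorem.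

*Invariance.* There is one unnormalized joint density `augWeight` of the coefficients `η` and the
auxiliary variables `(τ, ω)`: the update of `η` draws from its conditional given `(τ, ω)`, the
updates of `τ` and `ω` from its conditionals given `η`, and its `η`-marginal is the posterior weight.
That the conditional of `τ` is again truncated gamma rests on a scaling argument
(`Model.setLIntegral_gauss`): the constraint set is a cone in `u_α` and `u_B`, so the normalizing
constant of the truncated prior of `η` is a constant times `(τ_α τ_B)^(-(m + 2) / 2)`. For any joint
density the transition density is symmetric after multiplication with the marginal
(`augDensity_detailedBalance`); integrating gives invariance, once each conditional is a genuine
probability density. For the update of `η` this means that almost every slice has positive measure.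
It holds because the heights are continuous and the constraint set is convex with nonempty interior,
so that every state is a limit of interior points (`Model.volume_sliceSet_ne_zero`). The posterior is
proper, since `ξ_i ≥ 0` bounds the likelihood by `exp(yᵀ M η)` and `τ ≥ τ₀ > 0` leaves Gaussian
decay.

*Minorization.* Three bounds, none of which involves the current state, combine in
`Model.exists_mul_minorant_le_transDensity`. The normalizing constant of the update of `η` is at most
the integral of the tilted Gaussian kernel with `τ = (τ₀, τ₀)`. As all heights are at most `1`, the
slice variables fall below the heights of a given `η` with probability at least the product of
these heights. The precisions lie in `[τ₀, τ₀ + 1]` with probability bounded below, because a larger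
rate only moves truncated gamma mass to the left (`exists_le_setLIntegral_truncGammaPDF`); on that
event the Gaussian kernel is at least the one with precisions `τ₀ + 1`.

Doeblin's argument (`stepProb_oscillation`) turns the minorization and invariance into a geometric
rate: each step shrinks the oscillation of `x ↦ Kⁿ(x, A)` by the factor `1 - δ`, and the posterior
probability of `A` lies between its extreme values.
-/

namespace SliceGibbs

/-! ### Uniform ergodicity from a minorization -/

section Doeblin

variable {E : Type} [MeasurableSpace E]

/-- Only the values of the transition function on an absorbing set matter for the `n`-step
probabilities started there. -/
theorem stepProb_congr {S : Set E} {K K' : E → Measure E} (hK : ∀ x ∈ S, K x = K' x)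
    (hS : ∀ x ∈ S, K x Sᶜ = 0) (A : Set E) (n : ℕ) :
    ∀ x ∈ S, stepProb K n x A = stepProb K' n x A := by
  induction n with
  | zero => intro x _; rfl
  | succ n ih =>
    intro x hx
    have hae : ∀ᵐ z ∂(K x), z ∈ S := hS x hx
    simp only [stepProb]
    rw [← hK x hx]
    refine lintegral_congr_ae ?_
    filter_upwards [hae] with z hz using ih z hz

/-- The oscillation of `x ↦ Kⁿ(x, A)` over the state space shrinks by the factor `1 - δ` in each
step: the component `δ • ν` common to all `K x` contributes a constant. Everything is phrased
without measurability of `x ↦ Kⁿ(x, A)`. -/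
theorem stepProb_oscillation {S : Set E} {K : E → Measure E} (hK : IsMarkovOn S K)
    {δ : ℝ≥0∞} (hδ : δ ≤ 1) {ν : Measure E} [IsProbabilityMeasure ν]
    (hmin : ∀ x ∈ S, δ • ν ≤ K x) (A : Set E) (n : ℕ) :
    ∃ a : ℝ≥0∞, ∀ x ∈ S, a ≤ stepProb K n x A ∧ stepProb K n x A ≤ a + (1 - δ) ^ n := by
  induction n with
  | zero =>
    refine ⟨0, fun x _ => ⟨zero_le, ?_⟩⟩
    simp only [stepProb, pow_zero, zero_add]
    exact prob_le_one
  | succ n ih =>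
    obtain ⟨a, ha⟩ := ih
    refine ⟨(1 - δ) * a + δ * ∫⁻ z, stepProb K n z A ∂ν, fun x hx => ?_⟩
    have := (hK x hx).1
    have hδt : δ ≠ ∞ := ne_top_of_le_ne_top ENNReal.one_ne_top hδ
    have : IsFiniteMeasure (δ • ν) := ν.smul_finite hδt
    set ρ := K x - δ • ν with hρ
    have hsplit : ρ + δ • ν = K x := Measure.sub_add_cancel_of_le (hmin x hx)
    have hmass : ρ Set.univ = 1 - δ := by
      rw [hρ, Measure.sub_apply MeasurableSet.univ (hmin x hx)]
      simp
    have hae : ∀ᵐ z ∂ρ, z ∈ S := by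
      have h0 : K x Sᶜ = 0 := (hK x hx).2
      exact le_antisymm ((Measure.le_iff'.1 Measure.sub_le Sᶜ).trans h0.le) zero_le
    have hstep : stepProb K (n + 1) x A
        = ∫⁻ z, stepProb K n z A ∂ρ + δ * ∫⁻ z, stepProb K n z A ∂ν := by
      simp only [stepProb]
      rw [← hsplit, lintegral_add_measure, lintegral_smul_measure, smul_eq_mul]
    have hlow : (1 - δ) * a ≤ ∫⁻ z, stepProb K n z A ∂ρ := by
      calc (1 - δ) * a = ∫⁻ _, a ∂ρ := by rw [lintegral_const, hmass, mul_comm]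
        _ ≤ _ := lintegral_mono_ae (by filter_upwards [hae] with z hz using (ha z hz).1)
    have hupp : ∫⁻ z, stepProb K n z A ∂ρ ≤ (1 - δ) * a + (1 - δ) ^ (n + 1) := by
      calc ∫⁻ z, stepProb K n z A ∂ρ ≤ ∫⁻ _, (a + (1 - δ) ^ n) ∂ρ :=
            lintegral_mono_ae (by filter_upwards [hae] with z hz using (ha z hz).2)
        _ = _ := by rw [lintegral_const, hmass, add_mul, mul_comm a, pow_succ]
    rw [hstep]
    refine ⟨by gcongr, ?_⟩
    rw [add_right_comm]
    gcongr

/-- Doeblin's theorem: a minorization on the whole state space makes a chain with an invariant law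
uniformly ergodic. -/
theorem isUniformlyErgodic_of_minorization {S : Set E} {K : E → Measure E} (hK : IsMarkovOn S K)
    {δ : ℝ} (hδ₀ : 0 < δ) (hδ₁ : δ < 1) {ν : Measure E} [IsProbabilityMeasure ν]
    (hmin : ∀ x ∈ S, ENNReal.ofReal δ • ν ≤ K x) {P : Measure E} [IsProbabilityMeasure P]
    (hPS : P Sᶜ = 0)
    (hinv : ∀ A, MeasurableSet A → ∀ n, ∫⁻ x, stepProb K n x A ∂P = P A) :
    IsUniformlyErgodic S K P := by
  refine ⟨1, 1 - δ, by linarith, by linarith, fun x hx n A hA => ?_⟩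
  obtain ⟨a, ha⟩ := stepProb_oscillation hK (ENNReal.ofReal_le_one.2 hδ₁.le) hmin A n
  have hr : (1 - ENNReal.ofReal δ) ^ n = ENNReal.ofReal ((1 - δ) ^ n) := by
    rw [ENNReal.ofReal_pow (by linarith), ENNReal.ofReal_sub _ hδ₀.le, ENNReal.ofReal_one]
  rw [hr] at ha
  have hae : ∀ᵐ z ∂P, z ∈ S := hPS
  have hlow : a ≤ P A := by
    calc a = ∫⁻ _, a ∂P := by simp
      _ ≤ ∫⁻ x, stepProb K n x A ∂P :=
        lintegral_mono_ae (by filter_upwards [hae] with z hz using (ha z hz).1)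
      _ = P A := hinv A hA n
  have hupp : P A ≤ a + ENNReal.ofReal ((1 - δ) ^ n) := by
    calc P A = ∫⁻ x, stepProb K n x A ∂P := (hinv A hA n).symm
      _ ≤ ∫⁻ _, (a + ENNReal.ofReal ((1 - δ) ^ n)) ∂P :=
        lintegral_mono_ae (by filter_upwards [hae] with z hz using (ha z hz).2)
      _ = _ := by simp
  have hat : a ≠ ∞ := ne_top_of_le_ne_top (measure_ne_top P A) hlow
  have hr0 : 0 ≤ (1 - δ) ^ n := pow_nonneg (by linarith) n
  have hsum : a + ENNReal.ofReal ((1 - δ) ^ n) ≠ ∞ := by finiteness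
  have hreal : ∀ t : ℝ≥0∞, a ≤ t → t ≤ a + ENNReal.ofReal ((1 - δ) ^ n) →
      a.toReal ≤ t.toReal ∧ t.toReal ≤ a.toReal + (1 - δ) ^ n := by
    intro t h1 h2
    refine ⟨ENNReal.toReal_mono (ne_top_of_le_ne_top hsum h2) h1, ?_⟩
    have h := ENNReal.toReal_mono hsum h2
    rwa [ENNReal.toReal_add hat ENNReal.ofReal_ne_top, ENNReal.toReal_ofReal hr0] at h
  have h1 := hreal _ (ha x hx).1 (ha x hx).2
  have h2 := hreal _ hlow hupp
  rw [one_mul, abs_le]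
  constructor <;> linarith [h1.1, h1.2, h2.1, h2.2]

end Doeblin

/-! ### Data augmentation chains -/

section DataAugmentation

variable {X Y : Type} [MeasurableSpace X] [MeasurableSpace Y]

/-- The transition density `∫ f(x | y) f(y | x') dy` of the two-block Gibbs chain of an
unnormalized joint density `f` of a state `x` and an auxiliary variable `y`. -/
noncomputable def augDensity (μ : Measure X) (ν : Measure Y) (f : X → Y → ℝ≥0∞) (x' x : X) :
    ℝ≥0∞ :=
  ∫⁻ y, f x y / (∫⁻ z, f z y ∂μ) * (f x' y / ∫⁻ y, f x' y ∂ν) ∂ν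

variable {μ : Measure X} {ν : Measure Y} [SFinite μ] {f : X → Y → ℝ≥0∞}

theorem measurable_augDensity [SFinite ν] (hf : Measurable (Function.uncurry f)) :
    Measurable (Function.uncurry (augDensity μ ν f)) := by
  have h1 : Measurable fun x => ∫⁻ y, f x y ∂ν := hf.lintegral_prod_right'
  have h2 : Measurable fun y => ∫⁻ z, f z y ∂μ := hf.lintegral_prod_left'
  have ha : Measurable fun t : (X × X) × Y => f t.1.2 t.2 :=
    hf.comp (measurable_fst.snd.prodMk measurable_snd)
  have hb : Measurable fun t : (X × X) × Y => f t.1.1 t.2 :=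
    hf.comp (measurable_fst.fst.prodMk measurable_snd)
  have : Measurable fun t : (X × X) × Y =>
      f t.1.2 t.2 / (∫⁻ z, f z t.2 ∂μ) * (f t.1.1 t.2 / ∫⁻ y, f t.1.1 y ∂ν) :=
    (ha.div (h2.comp measurable_snd)).mul (hb.div (h1.comp measurable_fst.fst))
  exact this.lintegral_prod_right'

/-- The chain is reversible: both sides are `∫ f(x | y) f(x' | y) f(y) dy`. -/
theorem augDensity_detailedBalance (hf : Measurable (Function.uncurry f))
    (h1 : ∀ x, ∫⁻ y, f x y ∂ν ≠ ∞) (x' x : X) :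
    (∫⁻ y, f x' y ∂ν) * augDensity μ ν f x' x = (∫⁻ y, f x y ∂ν) * augDensity μ ν f x x' := by
  have h2 : Measurable fun y => ∫⁻ z, f z y ∂μ := hf.lintegral_prod_left'
  have hm : ∀ x, Measurable (f x) := fun x => hf.of_uncurry_left
  have key : ∀ x' x, (∫⁻ y, f x' y ∂ν) * augDensity μ ν f x' x
      = ∫⁻ y, f x y * f x' y / (∫⁻ z, f z y ∂μ) ∂ν := by
    intro x' x
    have hmeas : Measurable fun y =>
        f x y / (∫⁻ z, f z y ∂μ) * (f x' y / ∫⁻ y, f x' y ∂ν) :=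
      ((hm x).div h2).mul ((hm x').div_const _)
    unfold augDensity
    rw [← lintegral_const_mul _ hmeas]
    by_cases h0 : ∫⁻ y, f x' y ∂ν = 0
    · have hz : ∀ᵐ y ∂ν, f x' y = 0 := (lintegral_eq_zero_iff (hm x')).1 h0
      refine lintegral_congr_ae ?_
      filter_upwards [hz] with y hy
      simp [h0, hy]
    · refine lintegral_congr fun y => ?_
      rw [mul_left_comm, ENNReal.mul_div_cancel h0 (h1 x'), div_eq_mul_inv, div_eq_mul_inv,
        mul_right_comm]
  rw [key, key]
  simp only [mul_comm]

theorem lintegral_augDensity [SFinite ν] (hf : Measurable (Function.uncurry f))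
    (h1 : ∀ x, ∫⁻ y, f x y ∂ν ≠ ∞) (h2 : ∀ y, ∫⁻ x, f x y ∂μ ≠ ∞)
    (h0 : ∀ x, ∀ᵐ y ∂ν, f x y ≠ 0 → ∫⁻ z, f z y ∂μ ≠ 0) {x : X} (hx : ∫⁻ y, f x y ∂ν ≠ 0) :
    ∫⁻ z, augDensity μ ν f x z ∂μ = 1 := by
  have hm2 : Measurable fun y => ∫⁻ z, f z y ∂μ := hf.lintegral_prod_left'
  have hm : ∀ x, Measurable (f x) := fun x => hf.of_uncurry_left
  unfold augDensity
  rw [lintegral_lintegral_swap]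
  · calc ∫⁻ y, ∫⁻ z, f z y / (∫⁻ z, f z y ∂μ) * (f x y / ∫⁻ y, f x y ∂ν) ∂μ ∂ν
        = ∫⁻ y, f x y / (∫⁻ y, f x y ∂ν) ∂ν := by
          refine lintegral_congr_ae ?_
          filter_upwards [h0 x] with y hy
          have hmy : Measurable fun z => f z y := hf.of_uncurry_right
          simp only [div_eq_mul_inv]
          rw [lintegral_mul_const _ (hmy.mul_const _), lintegral_mul_const _ hmy]
          by_cases hxy : f x y = 0
          · simp [hxy]
          · rw [ENNReal.mul_inv_cancel (hy hxy) (h2 y), one_mul]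
      _ = 1 := by
          simp only [div_eq_mul_inv]
          rw [lintegral_mul_const _ (hm x), ENNReal.mul_inv_cancel hx (h1 x)]
  · have ha : Measurable fun t : X × Y => f t.1 t.2 := hf
    exact ((ha.div (hm2.comp measurable_snd)).mul
      (((hm x).comp measurable_snd).div_const _)).aemeasurable

/-- The marginal density of the state is invariant. -/
theorem lintegral_mul_augDensity [SFinite ν] (hf : Measurable (Function.uncurry f))
    (h1 : ∀ x, ∫⁻ y, f x y ∂ν ≠ ∞) (h2 : ∀ y, ∫⁻ x, f x y ∂μ ≠ ∞)
    (h0 : ∀ x, ∀ᵐ y ∂ν, f x y ≠ 0 → ∫⁻ z, f z y ∂μ ≠ 0) {g : X → ℝ≥0∞} (hg : Measurable g) :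
    ∫⁻ x, (∫⁻ y, f x y ∂ν) * ∫⁻ z, augDensity μ ν f x z * g z ∂μ ∂μ
      = ∫⁻ x, (∫⁻ y, f x y ∂ν) * g x ∂μ := by
  have hm1 : Measurable fun x => ∫⁻ y, f x y ∂ν := hf.lintegral_prod_right'
  have hk : Measurable (Function.uncurry (augDensity μ ν f)) := measurable_augDensity hf
  have hk1 : ∀ x, Measurable (augDensity μ ν f x) := fun x => hk.of_uncurry_left
  calc ∫⁻ x, (∫⁻ y, f x y ∂ν) * ∫⁻ z, augDensity μ ν f x z * g z ∂μ ∂μ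
      = ∫⁻ x, ∫⁻ z, (∫⁻ y, f x y ∂ν) * (augDensity μ ν f x z * g z) ∂μ ∂μ :=
        lintegral_congr fun x => (lintegral_const_mul _ ((hk1 x).mul hg)).symm
    _ = ∫⁻ z, ∫⁻ x, (∫⁻ y, f x y ∂ν) * (augDensity μ ν f x z * g z) ∂μ ∂μ :=
        lintegral_lintegral_swap
          ((hm1.comp measurable_fst).mul (hk.mul (hg.comp measurable_snd))).aemeasurable
    _ = ∫⁻ z, ∫⁻ x, (∫⁻ y, f z y ∂ν) * g z * augDensity μ ν f z x ∂μ ∂μ := by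
        refine lintegral_congr fun z => lintegral_congr fun x => ?_
        rw [← mul_assoc, augDensity_detailedBalance hf h1, mul_right_comm]
    _ = ∫⁻ x, (∫⁻ y, f x y ∂ν) * g x ∂μ := by
        refine lintegral_congr fun z => ?_
        rw [lintegral_const_mul _ (hk1 z)]
        by_cases hz : ∫⁻ y, f z y ∂ν = 0
        · simp [hz]
        · rw [lintegral_augDensity hf h1 h2 h0 hz, mul_one]

theorem measurable_stepProb_augDensity [SFinite ν] (hf : Measurable (Function.uncurry f)) {A : Set X}
    (hA : MeasurableSet A) (n : ℕ) :
    Measurable fun x => stepProb (fun x => μ.withDensity (augDensity μ ν f x)) n x A := by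
  have hk : Measurable (Function.uncurry (augDensity μ ν f)) := measurable_augDensity hf
  induction n with
  | zero =>
    simp only [stepProb, Measure.dirac_apply' _ hA]
    exact measurable_one.indicator hA
  | succ n ih =>
    have h : Measurable fun x => ∫⁻ z, augDensity μ ν f x z *
        stepProb (fun x => μ.withDensity (augDensity μ ν f x)) n z A ∂μ :=
      (hk.mul (ih.comp measurable_snd)).lintegral_prod_right'
    convert h using 2 with x
    exact lintegral_withDensity_eq_lintegral_mul _ hk.of_uncurry_left ih

theorem lintegral_stepProb_augDensity [SFinite ν] (hf : Measurable (Function.uncurry f))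
    (h1 : ∀ x, ∫⁻ y, f x y ∂ν ≠ ∞) (h2 : ∀ y, ∫⁻ x, f x y ∂μ ≠ ∞)
    (h0 : ∀ x, ∀ᵐ y ∂ν, f x y ≠ 0 → ∫⁻ z, f z y ∂μ ≠ 0) (c : ℝ≥0∞) {A : Set X}
    (hA : MeasurableSet A) (n : ℕ) :
    ∫⁻ x, stepProb (fun x => μ.withDensity (augDensity μ ν f x)) n x A
        ∂(μ.withDensity fun x => (∫⁻ y, f x y ∂ν) / c)
      = μ.withDensity (fun x => (∫⁻ y, f x y ∂ν) / c) A := by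
  have hm1 : Measurable fun x => ∫⁻ y, f x y ∂ν := hf.lintegral_prod_right'
  have hk : Measurable (Function.uncurry (augDensity μ ν f)) := measurable_augDensity hf
  have hw : ∀ g : X → ℝ≥0∞, Measurable g →
      ∫⁻ x, g x ∂(μ.withDensity fun x => (∫⁻ y, f x y ∂ν) / c)
        = c⁻¹ * ∫⁻ x, (∫⁻ y, f x y ∂ν) * g x ∂μ := by
    intro g hg
    have hmeas : Measurable fun x => (∫⁻ y, f x y ∂ν) * g x := hm1.mul hg
    rw [lintegral_withDensity_eq_lintegral_mul _ (hm1.div_const _) hg,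
      ← lintegral_const_mul _ hmeas]
    refine lintegral_congr fun x => ?_
    simp only [Pi.mul_apply, div_eq_mul_inv]
    rw [mul_comm _ c⁻¹, mul_assoc]
  induction n with
  | zero =>
    simp only [stepProb, Measure.dirac_apply' _ hA]
    rw [lintegral_indicator_one hA]
  | succ n ih =>
    have hn := measurable_stepProb_augDensity (μ := μ) (ν := ν) hf hA n
    rw [hw _ (measurable_stepProb_augDensity hf hA (n + 1)), ← ih, hw _ hn,
      ← lintegral_mul_augDensity hf h1 h2 h0 hn]
    congr 1
    refine lintegral_congr fun x => ?_
    simp only [stepProb]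
    rw [lintegral_withDensity_eq_lintegral_mul _ hk.of_uncurry_left hn]
    rfl

end DataAugmentation

/-! ### Truncated gamma weights -/

/-- The unnormalized density `1(t ≥ τ₀) t^(a-1) e^(-bt)` of the truncated gamma law. -/
noncomputable def gammaWeight (a b τ₀ t : ℝ) : ℝ≥0∞ :=
  (Set.Ici τ₀).indicator (fun t => ENNReal.ofReal (t ^ (a - 1) * Real.exp (-b * t))) t

section Gamma

variable {a b τ₀ : ℝ}

theorem measurable_gammaWeight (a b τ₀ : ℝ) : Measurable (gammaWeight a b τ₀) := by
  refine Measurable.indicator ?_ measurableSet_Ici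
  fun_prop

theorem lintegral_gammaWeight (a b τ₀ : ℝ) :
    ∫⁻ t, gammaWeight a b τ₀ t = truncGammaConst a b τ₀ :=
  lintegral_indicator measurableSet_Ici _

theorem truncGammaPDF_eq (a b τ₀ t : ℝ) :
    truncGammaPDF a b τ₀ t = gammaWeight a b τ₀ t / truncGammaConst a b τ₀ := by
  unfold truncGammaPDF gammaWeight
  by_cases h : t ∈ Set.Ici τ₀ <;> simp [h]

theorem measurable_truncGammaPDF (a b τ₀ : ℝ) : Measurable (truncGammaPDF a b τ₀) := by
  have : truncGammaPDF a b τ₀ = fun t => gammaWeight a b τ₀ t / truncGammaConst a b τ₀ :=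
    funext (truncGammaPDF_eq a b τ₀)
  rw [this]
  exact (measurable_gammaWeight a b τ₀).div_const _

theorem gammaWeight_ne_top (a b τ₀ t : ℝ) : gammaWeight a b τ₀ t ≠ ∞ := by
  unfold gammaWeight
  by_cases h : t ∈ Set.Ici τ₀ <;> simp [h]

theorem gammaWeight_of_lt {t : ℝ} (h : t < τ₀) : gammaWeight a b τ₀ t = 0 :=
  Set.indicator_of_notMem (by simpa using h) _

theorem gammaWeight_ne_zero (hτ : 0 < τ₀) {t : ℝ} (h : τ₀ ≤ t) : gammaWeight a b τ₀ t ≠ 0 := by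
  have ht : 0 < t := hτ.trans_le h
  unfold gammaWeight
  rw [Set.indicator_of_mem (by simpa using h)]
  exact (ENNReal.ofReal_pos.2 (by positivity)).ne'

theorem gammaWeight_mul_exp (a b τ₀ s t : ℝ) :
    gammaWeight a b τ₀ t * ENNReal.ofReal (Real.exp (-(s * t))) = gammaWeight a (b + s) τ₀ t := by
  unfold gammaWeight
  by_cases h : t ∈ Set.Ici τ₀
  · simp only [h, Set.indicator_of_mem]
    rw [← ENNReal.ofReal_mul' (Real.exp_pos _).le, mul_assoc, ← Real.exp_add]
    ring_nf
  · simp [h]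

theorem gammaWeight_mul_rpow (hτ : 0 < τ₀) (a b s t : ℝ) :
    gammaWeight a b τ₀ t * ENNReal.ofReal (t ^ s) = gammaWeight (a + s) b τ₀ t := by
  unfold gammaWeight
  by_cases h : t ∈ Set.Ici τ₀
  · have ht : 0 < t := hτ.trans_le h
    simp only [h, Set.indicator_of_mem]
    rw [← ENNReal.ofReal_mul' (Real.rpow_nonneg ht.le _), mul_right_comm, ← Real.rpow_add ht]
    ring_nf
  · simp [h]

theorem truncGammaConst_ne_top (ha : 0 < a) (hb : 0 < b) (hτ : 0 < τ₀) :
    truncGammaConst a b τ₀ ≠ ∞ := by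
  have h := (integrableOn_rpow_mul_exp_neg_mul_rpow (p := 1) (s := a - 1) (b := b)
    (by linarith) one_pos hb).mono_set (Set.Ici_subset_Ioi.2 hτ)
  simp only [Real.rpow_one] at h
  exact h.lintegral_lt_top.ne

theorem truncGammaConst_ne_zero (hτ : 0 < τ₀) : truncGammaConst a b τ₀ ≠ 0 := by
  rw [← lintegral_gammaWeight, Ne, lintegral_eq_zero_iff (measurable_gammaWeight a b τ₀)]
  intro h
  have h0 : volume (Set.Ici τ₀) = 0 :=
    measure_mono_null (fun t ht => gammaWeight_ne_zero hτ ht) (ae_iff.1 h)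
  simp at h0

/-- Raising the rate by `s` costs the normalizing constant at least the factor `e^(-s τ₀)`. -/
theorem truncGammaConst_add_le (a b τ₀ : ℝ) {s : ℝ} (hs : 0 ≤ s) :
    truncGammaConst a (b + s) τ₀
      ≤ truncGammaConst a b τ₀ * ENNReal.ofReal (Real.exp (-(s * τ₀))) := by
  rw [← lintegral_gammaWeight, ← lintegral_gammaWeight,
    ← lintegral_mul_const _ (measurable_gammaWeight a b τ₀)]
  refine lintegral_mono fun t => ?_
  rw [← gammaWeight_mul_exp]
  by_cases h : τ₀ ≤ t
  · gcongr
  · simp [gammaWeight_of_lt (not_le.1 h)]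

/-- Raising the rate of a truncated gamma law moves its mass to the left, so the mass on
`[τ₀, τ₀ + 1]` is bounded below uniformly over all larger rates. -/
theorem exists_le_setLIntegral_truncGammaPDF (ha : 0 < a) (hb : 0 < b) (hτ : 0 < τ₀) :
    ∃ c : ℝ≥0∞, c ≠ 0 ∧ ∀ s, 0 ≤ s →
      c ≤ ∫⁻ t in Set.Iic (τ₀ + 1), truncGammaPDF a (b + s) τ₀ t := by
  set T := τ₀ + 1
  have hm := fun b => measurable_gammaWeight a b τ₀
  set left : ℝ → ℝ≥0∞ := fun b => ∫⁻ t in Set.Iic T, gammaWeight a b τ₀ t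
  set right : ℝ → ℝ≥0∞ := fun b => ∫⁻ t in Set.Ioi T, gammaWeight a b τ₀ t
  have hsum : ∀ b, left b + right b = truncGammaConst a b τ₀ := by
    intro b
    rw [← lintegral_gammaWeight, ← lintegral_add_compl _ (measurableSet_Iic (a := T)),
      Set.compl_Iic]
  have htop := truncGammaConst_ne_top ha hb hτ
  have hleft : left b ≠ 0 := by
    intro h
    rw [lintegral_eq_zero_iff (hm b), Filter.EventuallyEq,
      ae_restrict_iff' measurableSet_Iic] at h
    have h0 : volume (Set.Icc τ₀ T) = 0 := by
      refine measure_mono_null (fun t ht => ?_) (ae_iff.1 h)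
      simp only [Set.mem_ofPred_eq, Classical.not_imp]
      exact ⟨ht.2, gammaWeight_ne_zero hτ ht.1⟩
    simp [T] at h0
  refine ⟨left b / truncGammaConst a b τ₀, (ENNReal.div_pos hleft htop).ne', fun s hs => ?_⟩
  have hint : ∫⁻ t in Set.Iic T, truncGammaPDF a (b + s) τ₀ t
      = left (b + s) / truncGammaConst a (b + s) τ₀ := by
    simp only [truncGammaPDF_eq, div_eq_mul_inv]
    rw [lintegral_mul_const _ (hm _)]
  -- Left of `T` the factor `e^(-st)` is at least `e^(-sT)`, right of `T` it is at most that.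
  set e := ENNReal.ofReal (Real.exp (-(s * T)))
  have hl : left b * e ≤ left (b + s) := by
    rw [← lintegral_mul_const _ (hm b)]
    refine setLIntegral_mono (hm _) fun t ht => ?_
    rw [← gammaWeight_mul_exp]
    have : t ≤ T := ht
    simp only [e]
    gcongr
  have hr : right (b + s) ≤ right b * e := by
    rw [← lintegral_mul_const _ (hm b)]
    refine setLIntegral_mono ((hm _).mul_const _) fun t ht => ?_
    rw [← gammaWeight_mul_exp]
    have : T ≤ t := le_of_lt ht
    simp only [e]
    gcongr
  rw [hint]
  have hb' : 0 < b + s := by linarith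
  rw [ENNReal.le_div_iff_mul_le (Or.inl (truncGammaConst_ne_zero hτ))
    (Or.inl (truncGammaConst_ne_top ha hb' hτ)), mul_comm, ← mul_div_assoc]
  refine ENNReal.div_le_of_le_mul ?_
  rw [← hsum, ← hsum, add_mul, mul_add]
  refine add_le_add le_rfl ?_
  calc right (b + s) * left b ≤ right b * e * left b := by gcongr
    _ = right b * (left b * e) := by ring
    _ ≤ right b * left (b + s) := by gcongr
    _ = left (b + s) * right b := mul_comm _ _

end Gamma

/-! ### Gaussian kernels -/

section Gauss

variable {ι : Type} [Fintype ι]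

theorem exists_pos_mul_dotProduct_self_le {Q : Matrix ι ι ℝ} (hQ : Q.PosDef) :
    ∃ c : ℝ, 0 < c ∧ ∀ x, c * (x ⬝ᵥ x) ≤ x ⬝ᵥ (Q *ᵥ x) := by
  set S : Set (ι → ℝ) := Metric.sphere 0 1
  have hcont : Continuous fun x : ι → ℝ => x ⬝ᵥ (Q *ᵥ x) := by fun_prop
  obtain ⟨c, hc, hcS⟩ : ∃ c : ℝ, 0 < c ∧ ∀ x ∈ S, c ≤ x ⬝ᵥ (Q *ᵥ x) := by
    have hS : IsCompact S := isCompact_sphere 0 1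
    rcases S.eq_empty_or_nonempty with h | h
    · exact ⟨1, one_pos, by simp [h]⟩
    · obtain ⟨x, hx, hmin⟩ := hS.exists_isMinOn h hcont.continuousOn
      have hx0 : x ≠ 0 := by rintro rfl; simp [S] at hx
      exact ⟨_, by simpa using hQ.dotProduct_mulVec_pos hx0, fun z hz => hmin hz⟩
  refine ⟨c / (Fintype.card ι + 1), by positivity, fun x => ?_⟩
  have hnorm : x ⬝ᵥ x ≤ (Fintype.card ι + 1) * ‖x‖ ^ 2 := by
    calc x ⬝ᵥ x = ∑ i, x i ^ 2 := by simp [dotProduct, sq]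
      _ ≤ ∑ _i : ι, ‖x‖ ^ 2 := Finset.sum_le_sum fun i _ => by
          rw [← sq_abs]
          exact pow_le_pow_left₀ (abs_nonneg _) (norm_le_pi_norm x i) 2
      _ ≤ _ := by simp; nlinarith [sq_nonneg ‖x‖]
  have hquad : c * ‖x‖ ^ 2 ≤ x ⬝ᵥ (Q *ᵥ x) := by
    by_cases hx : x = 0
    · simp [hx]
    · have hx' : 0 < ‖x‖ := norm_pos_iff.2 hx
      have h := hcS (‖x‖⁻¹ • x) (by simp [S, norm_smul, hx'.ne'])
      simp only [Matrix.mulVec_smul, smul_dotProduct, dotProduct_smul, smul_eq_mul] at h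
      calc c * ‖x‖ ^ 2 ≤ (‖x‖⁻¹ * (‖x‖⁻¹ * (x ⬝ᵥ (Q *ᵥ x)))) * ‖x‖ ^ 2 := by gcongr
        _ = _ := by field_simp
  calc c / (Fintype.card ι + 1) * (x ⬝ᵥ x)
      ≤ c / (Fintype.card ι + 1) * ((Fintype.card ι + 1) * ‖x‖ ^ 2) := by gcongr
    _ = c * ‖x‖ ^ 2 := by field_simp
    _ ≤ _ := hquad

theorem lintegral_exp_mul_gaussKernel_ne_top {Q : Matrix ι ι ℝ} (hQ : Q.PosDef) (v b : ι → ℝ) :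
    ∫⁻ x, ENNReal.ofReal (Real.exp (v ⬝ᵥ x)) * gaussKernel b Q x ≠ ∞ := by
  obtain ⟨c, hc, hcQ⟩ := exists_pos_mul_dotProduct_self_le hQ
  have hint := (GaussianFourier.integrable_cexp_neg_mul_sum_add (b := ((c / 2 : ℝ) : ℂ))
    (by simpa using by positivity) (fun i : ι => ((v i + c * b i : ℝ) : ℂ))).norm
  refine ne_top_of_le_ne_top (hint.const_mul (Real.exp (-(c / 2) * (b ⬝ᵥ b)))).lintegral_lt_top.ne
    (lintegral_mono fun x => ?_)
  unfold gaussKernel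
  rw [← ENNReal.ofReal_mul (Real.exp_pos _).le, ← Real.exp_add, Complex.norm_exp, ← Real.exp_add]
  refine ENNReal.ofReal_le_ofReal (Real.exp_le_exp.2 ?_)
  have hre : (-((c / 2 : ℝ) : ℂ) * ∑ i, ((x i : ℝ) : ℂ) ^ 2
      + ∑ i, ((v i + c * b i : ℝ) : ℂ) * (x i : ℂ)).re
      = -(c / 2) * (x ⬝ᵥ x) + (v ⬝ᵥ x + c * (b ⬝ᵥ x)) := by
    have : (-((c / 2 : ℝ) : ℂ) * ∑ i, ((x i : ℝ) : ℂ) ^ 2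
        + ∑ i, ((v i + c * b i : ℝ) : ℂ) * (x i : ℂ))
        = ((-(c / 2) * (x ⬝ᵥ x) + (v ⬝ᵥ x + c * (b ⬝ᵥ x)) : ℝ) : ℂ) := by
      simp only [dotProduct, Finset.mul_sum, ← Finset.sum_add_distrib]
      push_cast
      exact Finset.sum_congr rfl fun i _ => by ring
    rw [this, Complex.ofReal_re]
  rw [hre]
  have h := hcQ (x - b)
  have hexp : (x - b) ⬝ᵥ (x - b) = x ⬝ᵥ x - 2 * (b ⬝ᵥ x) + b ⬝ᵥ b := by
    rw [sub_dotProduct, dotProduct_sub, dotProduct_sub, dotProduct_comm x b]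
    ring
  rw [hexp] at h
  linarith

/-- Completing the square: a linear tilt `e^(v·x)` shifts the mean of a Gaussian kernel. -/
theorem exists_gaussKernel_eq_const_mul {Q : Matrix ι ι ℝ} (hQ : Q.IsSymm) {a b v : ι → ℝ}
    (h : Q *ᵥ a = v + Q *ᵥ b) :
    ∃ r : ℝ≥0∞, r ≠ 0 ∧ r ≠ ∞ ∧
      ∀ x, gaussKernel a Q x = r * (ENNReal.ofReal (Real.exp (v ⬝ᵥ x)) * gaussKernel b Q x) := by
  refine ⟨ENNReal.ofReal (Real.exp (1 / 2 * (b ⬝ᵥ (Q *ᵥ b)) - 1 / 2 * (a ⬝ᵥ (Q *ᵥ a)))),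
    (ENNReal.ofReal_pos.2 (Real.exp_pos _)).ne', ENNReal.ofReal_ne_top, fun x => ?_⟩
  unfold gaussKernel
  rw [← ENNReal.ofReal_mul (Real.exp_pos _).le, ← ENNReal.ofReal_mul (Real.exp_pos _).le,
    ← Real.exp_add, ← Real.exp_add]
  congr 2
  have hsymm : ∀ z, z ⬝ᵥ (Q *ᵥ x) = x ⬝ᵥ (Q *ᵥ z) := fun z => by
    rw [Matrix.dotProduct_mulVec, ← Matrix.mulVec_transpose, hQ.eq, dotProduct_comm]
  simp only [Matrix.mulVec_sub, sub_dotProduct, dotProduct_sub, hsymm]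
  rw [h]
  simp only [dotProduct_add, dotProduct_comm x v]
  ring

end Gauss

namespace Model

variable {N p m q : ℕ} (D : Model N p m q)

/-! ### The prior precision and the Gaussian weight of the coefficients -/

/-- The unnormalized density `exp(-½ (β - μ)ᵀ Σ⁻¹ (β - μ))` of the prior of `β`. -/
noncomputable def betaWeight (η : Coef p m) : ℝ≥0∞ :=
  ENNReal.ofReal
    (Real.exp (-(1 / 2) * ((η.beta - D.mu) ⬝ᵥ (D.cov⁻¹ *ᵥ (η.beta - D.mu)))))

/-- The exponential tilt `exp(yᵀ M η)`, the log-linear factor of the likelihood. -/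
noncomputable def tilt (η : Coef p m) : ℝ≥0∞ :=
  ENNReal.ofReal (Real.exp (D.y ⬝ᵥ (D.design *ᵥ η)))

/-- The unnormalized, untruncated prior density of `η` given `τ`. -/
noncomputable def gauss (τ : ℝ × ℝ) (η : Coef p m) : ℝ≥0∞ :=
  gaussKernel D.priorMean (D.precision τ) η

theorem dotProduct_precision_mulVec (τ : ℝ × ℝ) (x : Coef p m) :
    x ⬝ᵥ (D.precision τ *ᵥ x) = x.beta ⬝ᵥ (D.cov⁻¹ *ᵥ x.beta)
      + (τ.1 * (x.uA ⬝ᵥ x.uA) + τ.2 * (x.uB ⬝ᵥ x.uB)) := by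
  have hx : x = Sum.elim x.beta (Sum.elim x.uA x.uB) := by
    ext (i | i | i) <;> rfl
  conv_lhs => rw [hx]
  simp [precision, Matrix.fromBlocks_mulVec, Function.comp_def, Matrix.smul_mulVec,
    sumElim_dotProduct_sumElim]

theorem precision_isSymm (hcov : D.cov.PosDef) (τ : ℝ × ℝ) : (D.precision τ).IsSymm := by
  have h : D.cov⁻¹.IsSymm := by simpa using hcov.inv.isHermitian
  simp [precision, Matrix.IsSymm, Matrix.fromBlocks_transpose, h.eq]

theorem precision_posDef (hcov : D.cov.PosDef) {τ : ℝ × ℝ} (h₁ : 0 < τ.1) (h₂ : 0 < τ.2) :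
    (D.precision τ).PosDef := by
  refine Matrix.PosDef.of_dotProduct_mulVec_pos (by simpa using D.precision_isSymm hcov τ)
    fun (x : Coef p m) hx => ?_
  rw [star_trivial, dotProduct_precision_mulVec]
  have hβ : 0 ≤ x.beta ⬝ᵥ (D.cov⁻¹ *ᵥ x.beta) := by
    simpa using hcov.inv.posSemidef.dotProduct_mulVec_nonneg x.beta
  have hself : ∀ u : Fin (m + 2) → ℝ, 0 ≤ u ⬝ᵥ u := fun u =>
    Finset.sum_nonneg fun i _ => mul_self_nonneg _
  have hpos : ∀ u : Fin (m + 2) → ℝ, u ≠ 0 → 0 < u ⬝ᵥ u := fun u hu =>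
    (hself u).lt_of_ne fun h => hu (dotProduct_self_eq_zero.1 h.symm)
  have hA := mul_nonneg h₁.le (hself x.uA)
  have hB := mul_nonneg h₂.le (hself x.uB)
  by_cases hA0 : x.uA = 0
  · by_cases hB0 : x.uB = 0
    · have hβ0 : x.beta ≠ 0 := by
        intro h
        refine hx ?_
        ext (i | i | i)
        · exact congrFun h i
        · exact congrFun hA0 i
        · exact congrFun hB0 i
      have : 0 < x.beta ⬝ᵥ (D.cov⁻¹ *ᵥ x.beta) := by
        simpa using hcov.inv.dotProduct_mulVec_pos hβ0
      linarith
    · have := mul_pos h₂ (hpos _ hB0)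
      linarith
  · have := mul_pos h₁ (hpos _ hA0)
    linarith

theorem gauss_eq (τ : ℝ × ℝ) (η : Coef p m) :
    D.gauss τ η = D.betaWeight η *
      (ENNReal.ofReal (Real.exp (-((η.uA ⬝ᵥ η.uA) / 2 * τ.1))) *
        ENNReal.ofReal (Real.exp (-((η.uB ⬝ᵥ η.uB) / 2 * τ.2)))) := by
  have hβ : Coef.beta (η - D.priorMean) = η.beta - D.mu := by
    ext i; simp [Coef.beta, priorMean]
  have hA : Coef.uA (η - D.priorMean) = η.uA := by
    ext i; simp [Coef.uA, priorMean]
  have hB : Coef.uB (η - D.priorMean) = η.uB := by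
    ext i; simp [Coef.uB, priorMean]
  unfold gauss gaussKernel betaWeight
  rw [dotProduct_precision_mulVec, hβ, hA, hB, ← ENNReal.ofReal_mul (Real.exp_pos _).le,
    ← ENNReal.ofReal_mul (Real.exp_pos _).le, ← Real.exp_add, ← Real.exp_add]
  congr 2
  ring

theorem gauss_ne_zero (τ : ℝ × ℝ) (η : Coef p m) : D.gauss τ η ≠ 0 :=
  (ENNReal.ofReal_pos.2 (Real.exp_pos _)).ne'

theorem tilt_ne_zero (η : Coef p m) : D.tilt η ≠ 0 :=
  (ENNReal.ofReal_pos.2 (Real.exp_pos _)).ne'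

theorem betaWeight_ne_zero (η : Coef p m) : D.betaWeight η ≠ 0 :=
  (ENNReal.ofReal_pos.2 (Real.exp_pos _)).ne'

theorem continuous_beta : Continuous (Coef.beta : Coef p m → _) := by
  unfold Coef.beta; fun_prop

theorem continuous_uA : Continuous (Coef.uA : Coef p m → _) := by
  unfold Coef.uA; fun_prop

theorem continuous_uB : Continuous (Coef.uB : Coef p m → _) := by
  unfold Coef.uB; fun_prop

theorem measurable_tilt : Measurable D.tilt := by
  have : Continuous fun η : Coef p m => D.y ⬝ᵥ (D.design *ᵥ η) := by fun_prop
  exact (Real.continuous_exp.comp this).measurable.ennreal_ofReal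

theorem measurable_gauss : Measurable (Function.uncurry D.gauss) := by
  have h1 := continuous_beta (p := p) (m := m)
  have h2 := continuous_uA (p := p) (m := m)
  have h3 := continuous_uB (p := p) (m := m)
  have : Function.uncurry D.gauss = fun t : (ℝ × ℝ) × Coef p m => _ :=
    funext fun t => D.gauss_eq t.1 t.2
  rw [this]
  unfold betaWeight
  refine Measurable.mul (Continuous.measurable ?_).ennreal_ofReal
    (Measurable.mul (Continuous.measurable ?_).ennreal_ofReal
      (Continuous.measurable ?_).ennreal_ofReal)
  · fun_prop
  · fun_prop
  · fun_prop

theorem measurable_gauss_right (τ : ℝ × ℝ) : Measurable (D.gauss τ) :=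
  D.measurable_gauss.of_uncurry_left

theorem measurable_tilt_mul_gauss (τ : ℝ × ℝ) : Measurable fun η => D.tilt η * D.gauss τ η :=
  D.measurable_tilt.mul (D.measurable_gauss_right τ)

theorem gauss_anti (η : Coef p m) {τ τ' : ℝ × ℝ} (h₁ : τ.1 ≤ τ'.1) (h₂ : τ.2 ≤ τ'.2) :
    D.gauss τ' η ≤ D.gauss τ η := by
  have hself : ∀ u : Fin (m + 2) → ℝ, 0 ≤ u ⬝ᵥ u := fun u =>
    Finset.sum_nonneg fun i _ => mul_self_nonneg _
  have hA := hself η.uA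
  have hB := hself η.uB
  rw [gauss_eq, gauss_eq]
  gcongr

theorem lintegral_tilt_mul_gauss_ne_top (hcov : D.cov.PosDef) {τ : ℝ × ℝ} (h₁ : 0 < τ.1)
    (h₂ : 0 < τ.2) : ∫⁻ η, D.tilt η * D.gauss τ η ≠ ∞ := by
  have h := lintegral_exp_mul_gaussKernel_ne_top (D.precision_posDef hcov h₁ h₂)
    (D.designᵀ *ᵥ D.y) D.priorMean
  simpa only [tilt, gauss, Matrix.dotProduct_mulVec, Matrix.mulVec_transpose] using h

theorem lintegral_gauss_ne_top (hcov : D.cov.PosDef) {τ : ℝ × ℝ} (h₁ : 0 < τ.1)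
    (h₂ : 0 < τ.2) : ∫⁻ η, D.gauss τ η ≠ ∞ := by
  have h := lintegral_exp_mul_gaussKernel_ne_top (D.precision_posDef hcov h₁ h₂) 0 D.priorMean
  simpa [gauss] using h

/-- The update of `η` is the tilted prior density, restricted to the slice and normalized. -/
theorem etaPDF_eq (hcov : D.cov.PosDef) {τ : ℝ × ℝ} (h₁ : 0 < τ.1) (h₂ : 0 < τ.2)
    (ω : Fin N → ℝ) (η : Coef p m) :
    D.etaPDF ω τ η = (D.sliceSet ω).indicator (fun η => D.tilt η * D.gauss τ η) η /
      ∫⁻ z in D.sliceSet ω, D.tilt z * D.gauss τ z := by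
  have hdet : IsUnit (D.precision τ).det :=
    (Matrix.isUnit_iff_isUnit_det _).1 (D.precision_posDef hcov h₁ h₂).isUnit
  obtain ⟨r, hr0, hrt, hr⟩ := exists_gaussKernel_eq_const_mul (D.precision_isSymm hcov τ)
    (a := (D.precision τ)⁻¹ *ᵥ D.muStar τ) (b := D.priorMean) (v := D.designᵀ *ᵥ D.y)
    (by rw [Matrix.mulVec_mulVec, Matrix.mul_nonsing_inv _ hdet, Matrix.one_mulVec, muStar])
  have hr' : ∀ x, gaussKernel ((D.precision τ)⁻¹ *ᵥ D.muStar τ) (D.precision τ) x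
      = r * (D.tilt x * D.gauss τ x) := by
    intro x
    rw [hr, tilt, gauss, Matrix.dotProduct_mulVec, Matrix.mulVec_transpose]
  unfold etaPDF truncNormalPDF
  simp only [hr']
  rw [lintegral_const_mul _ (D.measurable_tilt_mul_gauss τ)]
  by_cases hη : η ∈ D.sliceSet ω
  · simp only [hη, Set.indicator_of_mem]
    rw [ENNReal.mul_div_mul_left _ _ hr0 hrt]
  · simp [hη]

/-! ### The constraint set and the slices -/

theorem convex_feasibleBeta : Convex ℝ D.feasibleBeta := by
  have : D.feasibleBeta = ⋂ j, {β | D.c j ≤ (D.R *ᵥ β) j} := by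
    ext β; simp [feasibleBeta]
  rw [this]
  refine convex_iInter fun j => ?_
  exact convex_halfSpace_ge (f := fun β => (D.R *ᵥ β) j)
    ⟨fun x y => by simp [Matrix.mulVec_add], fun c x => by simp [Matrix.mulVec_smul]⟩ _

theorem convex_feasible : Convex ℝ D.feasible := by
  intro x hx y hy a b ha hb hab
  refine ⟨D.convex_feasibleBeta hx.1 hy.1 ha hb hab, fun l => ?_⟩
  exact add_nonneg (mul_nonneg ha (hx.2 l)) (mul_nonneg hb (hy.2 l))

theorem isClosed_feasible : IsClosed D.feasible := by
  have h1 := continuous_beta (p := p) (m := m)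
  have h2 := continuous_uA (p := p) (m := m)
  have : D.feasible = (⋂ j, {η : Coef p m | D.c j ≤ (D.R *ᵥ η.beta) j})
      ∩ ⋂ l, {η : Coef p m | 0 ≤ η.uA l} := by
    ext η; simp [feasible, feasibleBeta]
  rw [this]
  refine (isClosed_iInter fun j => ?_).inter (isClosed_iInter fun l => ?_)
  · exact isClosed_le (by fun_prop) (by fun_prop)
  · exact isClosed_le (by fun_prop) (by fun_prop)

/-- A convex set of positive measure has interior points, since its frontier is null. -/
theorem interior_feasible_nonempty (hfeas : 0 < volume D.feasibleBeta) :
    (interior D.feasible).Nonempty := by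
  have hβ : (interior D.feasibleBeta).Nonempty := by
    by_contra h
    rw [Set.not_nonempty_iff_eq_empty] at h
    have h0 := D.convex_feasibleBeta.addHaar_frontier volume
    have hsub : D.feasibleBeta ⊆ frontier D.feasibleBeta := by
      rw [frontier, h, Set.sdiff_empty]
      exact subset_closure
    exact hfeas.ne' (measure_mono_null hsub h0)
  obtain ⟨β, hβ⟩ := hβ
  have h1 := continuous_beta (p := p) (m := m)
  have h2 := continuous_uA (p := p) (m := m)
  have hopen : IsOpen (Coef.beta ⁻¹' interior D.feasibleBeta
      ∩ ⋂ l, {η : Coef p m | 0 < η.uA l}) := by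
    refine (isOpen_interior.preimage h1).inter (isOpen_iInter_of_finite fun l => ?_)
    exact isOpen_lt (by fun_prop) (by fun_prop)
  refine ⟨Sum.elim β 1, interior_maximal ?_ hopen ⟨hβ, by simp [Coef.uA]⟩⟩
  rintro η ⟨hη1, hη2⟩
  simp only [Set.mem_iInter] at hη2
  exact ⟨interior_subset hη1, fun l => (hη2 l).le⟩

theorem volume_feasible_ne_zero (hfeas : 0 < volume D.feasibleBeta) :
    volume D.feasible ≠ 0 :=
  fun h => (isOpen_interior.measure_pos volume (D.interior_feasible_nonempty hfeas)).ne'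
    (measure_mono_null interior_subset h)

theorem height_pos (i : Fin N) (η : Coef p m) : 0 < D.height i η := Real.exp_pos _

theorem continuous_height (hξ : ∀ i, ConvexOn ℝ Set.univ (D.ξ i)) (i : Fin N) :
    Continuous (D.height i) := by
  have h : Continuous (D.ξ i) := continuousOn_univ.1 ((hξ i).continuousOn isOpen_univ)
  have h' : Continuous (D.linPred i) := by unfold linPred; fun_prop
  unfold height
  fun_prop

theorem measurableSet_sliceSet (hξ : ∀ i, ConvexOn ℝ Set.univ (D.ξ i)) (ω : Fin N → ℝ) :
    MeasurableSet (D.sliceSet ω) := by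
  have : D.sliceSet ω = D.feasible ∩ ⋂ i, {η | ω i ≤ D.height i η} := by
    ext η; simp [sliceSet]
  rw [this]
  refine D.isClosed_feasible.measurableSet.inter (MeasurableSet.iInter fun i => ?_)
  exact measurableSet_le measurable_const (D.continuous_height hξ i).measurable

/-- A slice strictly below the heights of a feasible state contains a relative neighbourhood of
that state in the constraint set, hence has positive measure. -/
theorem volume_sliceSet_ne_zero (hfeas : 0 < volume D.feasibleBeta)
    (hξ : ∀ i, ConvexOn ℝ Set.univ (D.ξ i)) {η : Coef p m} (hη : η ∈ D.feasible)
    {ω : Fin N → ℝ} (hω : ∀ i, ω i < D.height i η) : volume (D.sliceSet ω) ≠ 0 := by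
  set W := ⋂ i, {z : Coef p m | ω i < D.height i z} with hW
  have hWo : IsOpen W := isOpen_iInter_of_finite fun i =>
    isOpen_lt continuous_const (D.continuous_height hξ i)
  have hηW : η ∈ W := by simpa [hW] using hω
  have hcl : η ∈ closure (interior D.feasible) := by
    rw [D.convex_feasible.closure_interior_eq_closure_of_nonempty_interior
      (D.interior_feasible_nonempty hfeas)]
    exact subset_closure hη
  have hne : (W ∩ interior D.feasible).Nonempty := mem_closure_iff.1 hcl W hWo hηW
  have hpos := (hWo.inter isOpen_interior).measure_pos volume hne
  refine fun h => hpos.ne' (measure_mono_null ?_ h)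
  rintro z ⟨hz1, hz2⟩
  simp only [hW, Set.mem_iInter] at hz1
  exact ⟨interior_subset hz2, fun i => (hz1 i).le⟩

/-- The constraint set is invariant under positive scalings of `u_α` and `u_B`, so the normalizing
constant of the truncated prior of `η` is proportional to `(τ_α τ_B)^(-(m + 2) / 2)`. This
cancellation makes the conditional law of `τ` given `η` a truncated gamma law. -/
theorem setLIntegral_gauss {τ : ℝ × ℝ} (h₁ : 0 < τ.1) (h₂ : 0 < τ.2) :
    ENNReal.ofReal (τ.1 ^ (((m : ℝ) + 2) / 2)) * ENNReal.ofReal (τ.2 ^ (((m : ℝ) + 2) / 2)) *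
      ∫⁻ η in D.feasible, D.gauss τ η = ∫⁻ η in D.feasible, D.gauss (1, 1) η := by
  set d : Idx p m → ℝ := Sum.elim 1 (Sum.elim (fun _ => (√τ.1)⁻¹) (fun _ => (√τ.2)⁻¹)) with hd
  have hdet : (Matrix.diagonal d).det = (√τ.1)⁻¹ ^ (m + 2) * (√τ.2)⁻¹ ^ (m + 2) := by
    simp [Matrix.det_diagonal, hd, Fintype.prod_sum_type]
  have hs₁ := Real.sqrt_pos.2 h₁
  have hs₂ := Real.sqrt_pos.2 h₂
  have hdet0 : 0 < (Matrix.diagonal d).det := by rw [hdet]; positivity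
  have hlin : ∀ η : Coef p m, Matrix.toLin' (Matrix.diagonal d) η = fun i => d i * η i := by
    intro η; ext i; simp [Matrix.toLin'_apply, Matrix.mulVec_diagonal]
  have hmeas : Measurable (Matrix.toLin' (Matrix.diagonal d)) :=
    (LinearMap.continuous_of_finiteDimensional _).measurable
  have hgm : Measurable (D.feasible.indicator (D.gauss τ)) :=
    (D.measurable_gauss_right τ).indicator D.isClosed_feasible.measurableSet
  have hscale : ∀ η : Coef p m,
      D.feasible.indicator (D.gauss τ) (Matrix.toLin' (Matrix.diagonal d) η)
        = D.feasible.indicator (D.gauss (1, 1)) η := by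
    intro η
    rw [hlin]
    set z : Coef p m := fun i => d i * η i
    have hβ : Coef.beta z = η.beta := by ext i; simp [Coef.beta, z, hd]
    have hA : Coef.uA z = (√τ.1)⁻¹ • η.uA := by ext i; simp [Coef.uA, z, hd]
    have hB : Coef.uB z = (√τ.2)⁻¹ • η.uB := by ext i; simp [Coef.uB, z, hd]
    have hmem : z ∈ D.feasible ↔ η ∈ D.feasible := by
      simp only [feasible, Set.mem_ofPred_eq, hβ, hA, Pi.smul_apply, smul_eq_mul]
      simp only [mul_nonneg_iff_of_pos_left (inv_pos.2 hs₁)]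
    have hval : D.gauss τ z = D.gauss (1, 1) η := by
      have e₁ : (√τ.1)⁻¹ * ((√τ.1)⁻¹ * (η.uA ⬝ᵥ η.uA)) / 2 * τ.1 = (η.uA ⬝ᵥ η.uA) / 2 * 1 := by
        nth_rw 3 [← Real.mul_self_sqrt h₁.le]
        field_simp
      have e₂ : (√τ.2)⁻¹ * ((√τ.2)⁻¹ * (η.uB ⬝ᵥ η.uB)) / 2 * τ.2 = (η.uB ⬝ᵥ η.uB) / 2 * 1 := by
        nth_rw 3 [← Real.mul_self_sqrt h₂.le]
        field_simp
      rw [gauss_eq, gauss_eq, betaWeight, betaWeight, hβ, hA, hB]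
      simp only [smul_dotProduct, dotProduct_smul, smul_eq_mul, e₁, e₂]
    by_cases h : η ∈ D.feasible
    · rw [Set.indicator_of_mem h, Set.indicator_of_mem (hmem.2 h), hval]
    · rw [Set.indicator_of_notMem h, Set.indicator_of_notMem (fun h' => h (hmem.1 h'))]
  have hrpow : ∀ t : ℝ, 0 < t → t ^ (((m : ℝ) + 2) / 2) = √t ^ (m + 2) := by
    intro t ht
    rw [Real.sqrt_eq_rpow, ← Real.rpow_natCast, ← Real.rpow_mul ht.le]
    push_cast
    ring_nf
  rw [← lintegral_indicator D.isClosed_feasible.measurableSet,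
    ← lintegral_indicator D.isClosed_feasible.measurableSet]
  conv_lhs => rw [← Real.smul_map_diagonal_volume_pi hdet0.ne']
  rw [lintegral_smul_measure, lintegral_map hgm hmeas, lintegral_congr hscale, smul_eq_mul,
    ← mul_assoc, abs_of_pos hdet0, hdet, hrpow _ h₁, hrpow _ h₂,
    ← ENNReal.ofReal_mul (by positivity), ← ENNReal.ofReal_mul (by positivity)]
  have : √τ.1 ^ (m + 2) * √τ.2 ^ (m + 2) * ((√τ.1)⁻¹ ^ (m + 2) * (√τ.2)⁻¹ ^ (m + 2)) = 1 := by
    rw [mul_mul_mul_comm, ← mul_pow, ← mul_pow, mul_inv_cancel₀ hs₁.ne', mul_inv_cancel₀ hs₂.ne']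
    simp
  rw [this, ENNReal.ofReal_one, one_mul]

/-! ### The joint density of coefficients and auxiliary variables -/

/-- The unnormalized density of `τ` in the joint law of `(η, τ, ω)`. Its shape is
`a₀ + (m + 2) / 2` instead of `a₀`, because it includes the factor by which the normalizing constant
of the prior of `η` depends on `τ`. -/
noncomputable def tauWeight (τ : ℝ × ℝ) : ℝ≥0∞ :=
  gammaWeight (D.a₀ + ((m : ℝ) + 2) / 2) D.b₀ D.τ₀ τ.1 *
    gammaWeight (D.a₀ + ((m : ℝ) + 2) / 2) D.b₀ D.τ₀ τ.2

/-- The unnormalized joint density of the coefficients `η` and the auxiliary variables `(τ, ω)`. -/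
noncomputable def augWeight (η : Coef p m) (y : (ℝ × ℝ) × (Fin N → ℝ)) : ℝ≥0∞ :=
  (D.sliceSet y.2).indicator (fun η => D.tilt η * D.gauss y.1 η) η *
    ((Set.Ici 0).indicator 1 y.2 * D.tauWeight y.1)

/-- The box `∏ [0, exp(-ξ_i(m_iᵀ η))]` of the slice variables compatible with `η`. -/
def box (η : Coef p m) : Set (Fin N → ℝ) := Set.Icc 0 fun i => D.height i η

/-- The unnormalized conditional density of `τ` given `η`. -/
noncomputable def condTauWeight (η : Coef p m) (τ : ℝ × ℝ) : ℝ≥0∞ :=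
  gammaWeight (D.a₀ + ((m : ℝ) + 2) / 2) (D.b₀ + (η.uA ⬝ᵥ η.uA) / 2) D.τ₀ τ.1 *
    gammaWeight (D.a₀ + ((m : ℝ) + 2) / 2) (D.b₀ + (η.uB ⬝ᵥ η.uB) / 2) D.τ₀ τ.2

/-- The normalizing constant of the conditional density of `τ` given `η`. -/
noncomputable def condTauConst (η : Coef p m) : ℝ≥0∞ :=
  truncGammaConst (D.a₀ + ((m : ℝ) + 2) / 2) (D.b₀ + (η.uA ⬝ᵥ η.uA) / 2) D.τ₀ *
    truncGammaConst (D.a₀ + ((m : ℝ) + 2) / 2) (D.b₀ + (η.uB ⬝ᵥ η.uB) / 2) D.τ₀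

theorem dotProduct_self_half_nonneg (u : Fin (m + 2) → ℝ) : 0 ≤ (u ⬝ᵥ u) / 2 :=
  div_nonneg (Finset.sum_nonneg fun _ _ => mul_self_nonneg _) zero_le_two

theorem measurable_tauWeight : Measurable D.tauWeight :=
  ((measurable_gammaWeight _ _ _).comp measurable_fst).mul
    ((measurable_gammaWeight _ _ _).comp measurable_snd)

theorem tauWeight_ne_top (τ : ℝ × ℝ) : D.tauWeight τ ≠ ∞ :=
  ENNReal.mul_ne_top (gammaWeight_ne_top _ _ _ _) (gammaWeight_ne_top _ _ _ _)

theorem le_of_tauWeight_ne_zero {τ : ℝ × ℝ} (h : D.tauWeight τ ≠ 0) :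
    D.τ₀ ≤ τ.1 ∧ D.τ₀ ≤ τ.2 := by
  by_contra h'
  rw [not_and_or, not_le, not_le] at h'
  rcases h' with h' | h' <;> exact h (by simp [tauWeight, gammaWeight_of_lt h'])

theorem gauss_mul_tauWeight (η : Coef p m) (τ : ℝ × ℝ) :
    D.gauss τ η * D.tauWeight τ = D.betaWeight η * D.condTauWeight η τ := by
  rw [gauss_eq, tauWeight, condTauWeight, ← gammaWeight_mul_exp, ← gammaWeight_mul_exp]
  ring

theorem measurable_condTauWeight (η : Coef p m) : Measurable (D.condTauWeight η) :=
  ((measurable_gammaWeight _ _ _).comp measurable_fst).mul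
    ((measurable_gammaWeight _ _ _).comp measurable_snd)

theorem lintegral_condTauWeight (η : Coef p m) :
    ∫⁻ τ, D.condTauWeight η τ = D.condTauConst η := by
  unfold condTauWeight condTauConst
  rw [Measure.volume_eq_prod, lintegral_prod_mul (measurable_gammaWeight _ _ _).aemeasurable
    (measurable_gammaWeight _ _ _).aemeasurable, lintegral_gammaWeight, lintegral_gammaWeight]

theorem condTauConst_ne_zero (hτ : 0 < D.τ₀) (η : Coef p m) : D.condTauConst η ≠ 0 :=
  mul_ne_zero (truncGammaConst_ne_zero hτ) (truncGammaConst_ne_zero hτ)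

theorem condTauConst_ne_top (ha : 0 < D.a₀) (hb : 0 < D.b₀) (hτ : 0 < D.τ₀) (η : Coef p m) :
    D.condTauConst η ≠ ∞ := by
  have hA := dotProduct_self_half_nonneg η.uA
  have hB := dotProduct_self_half_nonneg η.uB
  exact ENNReal.mul_ne_top (truncGammaConst_ne_top (by positivity) (by positivity) hτ)
    (truncGammaConst_ne_top (by positivity) (by positivity) hτ)

theorem measurableSet_box (η : Coef p m) : MeasurableSet (D.box η) := measurableSet_Icc

theorem volume_box (η : Coef p m) :
    volume (D.box η) = ∏ i, ENNReal.ofReal (D.height i η) := by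
  simp [box, Real.volume_Icc_pi]

theorem prod_height_ne_zero (η : Coef p m) : ∏ i, ENNReal.ofReal (D.height i η) ≠ 0 :=
  Finset.prod_ne_zero_iff.2 fun i _ => (ENNReal.ofReal_pos.2 (D.height_pos i η)).ne'

theorem prod_height_ne_top (η : Coef p m) : ∏ i, ENNReal.ofReal (D.height i η) ≠ ∞ :=
  ENNReal.prod_ne_top fun _ _ => ENNReal.ofReal_ne_top

theorem likelihood_eq (η : Coef p m) :
    D.likelihood η = D.tilt η * ∏ i, ENNReal.ofReal (D.height i η) := by
  unfold likelihood tilt height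
  rw [ENNReal.ofReal_mul (Real.exp_pos _).le, ← Finset.sum_neg_distrib, Real.exp_sum,
    ENNReal.ofReal_prod_of_nonneg fun i _ => (Real.exp_pos _).le]

theorem augWeight_eq (η : Coef p m) (y : (ℝ × ℝ) × (Fin N → ℝ)) :
    D.augWeight η y = D.feasible.indicator (fun η => D.tilt η * D.betaWeight η) η *
      (D.condTauWeight η y.1 * (D.box η).indicator 1 y.2) := by
  unfold augWeight
  by_cases hη : η ∈ D.feasible
  · by_cases h0 : y.2 ∈ Set.Ici 0
    · by_cases hy : ∀ i, y.2 i ≤ D.height i η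
      · have h1 : η ∈ D.sliceSet y.2 := ⟨hη, hy⟩
        have h2 : y.2 ∈ D.box η := ⟨h0, hy⟩
        simp only [h1, h2, h0, hη, Set.indicator_of_mem, Pi.one_apply, one_mul, mul_one]
        rw [mul_assoc, gauss_mul_tauWeight, mul_assoc]
      · have h1 : η ∉ D.sliceSet y.2 := fun h => hy h.2
        have h2 : y.2 ∉ D.box η := fun h => hy h.2
        simp [h1, h2]
    · have h2 : y.2 ∉ D.box η := fun h => h0 h.1
      simp only [h0, h2, Set.indicator_of_notMem, not_false_eq_true, zero_mul, mul_zero]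
  · have h1 : η ∉ D.sliceSet y.2 := fun h => hη h.1
    simp [h1, hη]

theorem measurable_augWeight (hξ : ∀ i, ConvexOn ℝ Set.univ (D.ξ i)) :
    Measurable (Function.uncurry D.augWeight) := by
  have hS : MeasurableSet {t : Coef p m × ((ℝ × ℝ) × (Fin N → ℝ)) | t.1 ∈ D.sliceSet t.2.2} := by
    have : {t : Coef p m × ((ℝ × ℝ) × (Fin N → ℝ)) | t.1 ∈ D.sliceSet t.2.2}
        = Prod.fst ⁻¹' D.feasible ∩ ⋂ i, {t | t.2.2 i ≤ D.height i t.1} := by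
      ext t; simp [sliceSet]
    rw [this]
    refine (measurable_fst D.isClosed_feasible.measurableSet).inter
      (MeasurableSet.iInter fun i => ?_)
    exact measurableSet_le ((measurable_pi_apply i).comp measurable_snd.snd)
      ((D.continuous_height hξ i).measurable.comp measurable_fst)
  have hp : Measurable fun t : Coef p m × ((ℝ × ℝ) × (Fin N → ℝ)) => (t.2.1, t.1) :=
    (measurable_fst.comp measurable_snd).prodMk measurable_fst
  have hg : Measurable fun t : Coef p m × ((ℝ × ℝ) × (Fin N → ℝ)) => D.gauss t.2.1 t.1 := by
    have h := D.measurable_gauss.comp hp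
    exact h
  have h1 : Measurable fun t : Coef p m × ((ℝ × ℝ) × (Fin N → ℝ)) =>
      D.tilt t.1 * D.gauss t.2.1 t.1 :=
    (D.measurable_tilt.comp measurable_fst).mul hg
  have h2 : Measurable fun ω : Fin N → ℝ => (Set.Ici 0).indicator (1 : (Fin N → ℝ) → ℝ≥0∞) ω :=
    measurable_one.indicator measurableSet_Ici
  have h3 : Measurable fun y : (ℝ × ℝ) × (Fin N → ℝ) =>
      (Set.Ici 0).indicator (1 : (Fin N → ℝ) → ℝ≥0∞) y.2 * D.tauWeight y.1 :=
    (h2.comp measurable_snd).mul (D.measurable_tauWeight.comp measurable_fst)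
  have heq : Function.uncurry D.augWeight = fun t =>
      {t : Coef p m × ((ℝ × ℝ) × (Fin N → ℝ)) | t.1 ∈ D.sliceSet t.2.2}.indicator
        (fun t => D.tilt t.1 * D.gauss t.2.1 t.1) t *
        ((Set.Ici 0).indicator (1 : (Fin N → ℝ) → ℝ≥0∞) t.2.2 * D.tauWeight t.2.1) := by
    funext t
    by_cases h : t.1 ∈ D.sliceSet t.2.2
    · simp only [Function.uncurry, augWeight, h, Set.indicator_of_mem, Set.mem_ofPred_eq]
    · simp only [Function.uncurry, augWeight, h, Set.indicator_of_notMem, Set.mem_ofPred_eq,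
        not_false_eq_true]
  rw [heq]
  exact (h1.indicator hS).mul (h3.comp measurable_snd)

theorem lintegral_augWeight (η : Coef p m) :
    ∫⁻ y, D.augWeight η y = D.feasible.indicator (fun η => D.tilt η * D.betaWeight η) η *
      (D.condTauConst η * ∏ i, ENNReal.ofReal (D.height i η)) := by
  have h1 := D.measurable_condTauWeight η
  have h2 : Measurable ((D.box η).indicator (1 : (Fin N → ℝ) → ℝ≥0∞)) :=
    measurable_one.indicator (D.measurableSet_box η)
  have h3 : Measurable fun y : (ℝ × ℝ) × (Fin N → ℝ) =>
      D.condTauWeight η y.1 * (D.box η).indicator 1 y.2 :=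
    (h1.comp measurable_fst).mul (h2.comp measurable_snd)
  simp only [augWeight_eq]
  rw [lintegral_const_mul _ h3,
    Measure.volume_eq_prod, lintegral_prod_mul h1.aemeasurable h2.aemeasurable,
    lintegral_condTauWeight, lintegral_indicator_one (D.measurableSet_box η), volume_box]

theorem tilt_mul_betaWeight_ne_zero (η : Coef p m) : D.tilt η * D.betaWeight η ≠ 0 :=
  mul_ne_zero (D.tilt_ne_zero η) (D.betaWeight_ne_zero η)

theorem tilt_mul_betaWeight_ne_top (η : Coef p m) : D.tilt η * D.betaWeight η ≠ ∞ :=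
  ENNReal.mul_ne_top ENNReal.ofReal_ne_top ENNReal.ofReal_ne_top

theorem lintegral_augWeight_ne_top (ha : 0 < D.a₀) (hb : 0 < D.b₀) (hτ : 0 < D.τ₀)
    (η : Coef p m) : ∫⁻ y, D.augWeight η y ≠ ∞ := by
  rw [lintegral_augWeight]
  refine ENNReal.mul_ne_top ?_
    (ENNReal.mul_ne_top (D.condTauConst_ne_top ha hb hτ η) (D.prod_height_ne_top η))
  by_cases h : η ∈ D.feasible
  · simpa only [h, Set.indicator_of_mem] using D.tilt_mul_betaWeight_ne_top η
  · simp [h]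

theorem lintegral_augWeight_ne_zero (hτ : 0 < D.τ₀) {η : Coef p m} (hη : η ∈ D.feasible) :
    ∫⁻ y, D.augWeight η y ≠ 0 := by
  rw [lintegral_augWeight, Set.indicator_of_mem hη]
  exact mul_ne_zero (D.tilt_mul_betaWeight_ne_zero η)
    (mul_ne_zero (D.condTauConst_ne_zero hτ η) (D.prod_height_ne_zero η))

theorem lintegral_augWeight_left (hξ : ∀ i, ConvexOn ℝ Set.univ (D.ξ i))
    (y : (ℝ × ℝ) × (Fin N → ℝ)) :
    ∫⁻ η, D.augWeight η y = (∫⁻ η in D.sliceSet y.2, D.tilt η * D.gauss y.1 η) *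
      ((Set.Ici 0).indicator 1 y.2 * D.tauWeight y.1) := by
  have hS := D.measurableSet_sliceSet hξ y.2
  unfold augWeight
  rw [lintegral_mul_const _ ((D.measurable_tilt_mul_gauss y.1).indicator hS),
    lintegral_indicator hS]

theorem setLIntegral_tilt_mul_gauss_ne_top (hcov : D.cov.PosDef) {τ : ℝ × ℝ} (h₁ : 0 < τ.1)
    (h₂ : 0 < τ.2) (S : Set (Coef p m)) : ∫⁻ η in S, D.tilt η * D.gauss τ η ≠ ∞ :=
  ne_top_of_le_ne_top (D.lintegral_tilt_mul_gauss_ne_top hcov h₁ h₂) (setLIntegral_le_lintegral _ _)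

theorem lintegral_augWeight_left_ne_top (hτ : 0 < D.τ₀) (hcov : D.cov.PosDef)
    (hξ : ∀ i, ConvexOn ℝ Set.univ (D.ξ i)) (y : (ℝ × ℝ) × (Fin N → ℝ)) :
    ∫⁻ η, D.augWeight η y ≠ ∞ := by
  rw [lintegral_augWeight_left D hξ]
  by_cases h : D.tauWeight y.1 = 0
  · simp [h]
  · obtain ⟨h₁, h₂⟩ := D.le_of_tauWeight_ne_zero h
    refine ENNReal.mul_ne_top
      (D.setLIntegral_tilt_mul_gauss_ne_top hcov (hτ.trans_le h₁) (hτ.trans_le h₂) _)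
      (ENNReal.mul_ne_top ?_ (D.tauWeight_ne_top _))
    by_cases h0 : y.2 ∈ Set.Ici 0
    · simp only [h0, Set.indicator_of_mem, Pi.one_apply, ne_eq, ENNReal.one_ne_top,
        not_false_eq_true]
    · simp only [h0, Set.indicator_of_notMem, not_false_eq_true, ne_eq, ENNReal.zero_ne_top]

/-- Almost every draw of the auxiliary variables leaves a slice of positive measure, so the update
of `η` is well defined: the slice variables almost surely avoid the upper faces of the box. -/
theorem ae_lintegral_augWeight_left_ne_zero (hfeas : 0 < volume D.feasibleBeta)
    (hξ : ∀ i, ConvexOn ℝ Set.univ (D.ξ i)) (η : Coef p m) :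
    ∀ᵐ y : (ℝ × ℝ) × (Fin N → ℝ), D.augWeight η y ≠ 0 → ∫⁻ z, D.augWeight z y ≠ 0 := by
  have hne : ∀ᵐ ω : Fin N → ℝ, ∀ i, ω i ≠ D.height i η :=
    ae_all_iff.2 fun i => Measure.ae_eval_ne (fun _ : Fin N => (volume : Measure ℝ)) i (D.height i η)
  have hne' : ∀ᵐ y : (ℝ × ℝ) × (Fin N → ℝ), ∀ i, y.2 i ≠ D.height i η :=
    Measure.quasiMeasurePreserving_snd.ae hne
  filter_upwards [hne'] with y hy h
  rw [lintegral_augWeight_left D hξ]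
  unfold augWeight at h
  refine mul_ne_zero ?_ (right_ne_zero_of_mul h)
  have hmem : η ∈ D.sliceSet y.2 := by
    by_contra h'
    simp [h'] at h
  have hvol := D.volume_sliceSet_ne_zero hfeas hξ hmem.1
    fun i => (hmem.2 i).lt_of_ne (hy i)
  rw [Ne, lintegral_eq_zero_iff (D.measurable_tilt_mul_gauss y.1)]
  intro h0
  rw [Filter.EventuallyEq, ae_restrict_iff' (D.measurableSet_sliceSet hξ y.2)] at h0
  refine hvol (measure_mono_null (fun z hz => ?_) (ae_iff.1 h0))
  simp only [Set.mem_ofPred_eq, Classical.not_imp]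
  exact ⟨hz, mul_ne_zero (D.tilt_ne_zero z) (D.gauss_ne_zero _ z)⟩

/-! ### The sampler as a data augmentation chain -/

theorem omegaPDF_eq (η : Coef p m) (ω : Fin N → ℝ) :
    D.omegaPDF η ω = (D.box η).indicator 1 ω / ∏ i, ENNReal.ofReal (D.height i η) := by
  unfold omegaPDF
  by_cases h : ω ∈ D.box η
  · have h' : ∀ i, ω i ∈ Set.Icc 0 (D.height i η) := fun i => ⟨h.1 i, h.2 i⟩
    simp only [h, h', Set.indicator_of_mem, Pi.one_apply, one_div]
    exact (ENNReal.prod_inv_distrib fun i _ j _ _ => Or.inr ENNReal.ofReal_ne_top).symm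
  · have h' : ∃ i, ω i ∉ Set.Icc 0 (D.height i η) := by
      by_contra! h'
      exact h ⟨fun i => (h' i).1, fun i => (h' i).2⟩
    obtain ⟨i, hi⟩ := h'
    rw [Finset.prod_eq_zero (Finset.mem_univ i) (Set.indicator_of_notMem hi _)]
    simp [h]

theorem tauPDF_eq (hτ : 0 < D.τ₀) (η : Coef p m) (τ : ℝ × ℝ) :
    D.tauPDF η τ = D.condTauWeight η τ / D.condTauConst η := by
  unfold tauPDF condTauWeight condTauConst
  rw [truncGammaPDF_eq, truncGammaPDF_eq]
  simp only [div_eq_mul_inv]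
  rw [ENNReal.mul_inv (Or.inl (truncGammaConst_ne_zero hτ))
    (Or.inr (truncGammaConst_ne_zero hτ))]
  ring

theorem omegaPDF_mul_tauPDF (hτ : 0 < D.τ₀) {η : Coef p m} (hη : η ∈ D.feasible)
    (y : (ℝ × ℝ) × (Fin N → ℝ)) :
    D.omegaPDF η y.2 * D.tauPDF η y.1 = D.augWeight η y / ∫⁻ y, D.augWeight η y := by
  rw [omegaPDF_eq, D.tauPDF_eq hτ, lintegral_augWeight, augWeight_eq, Set.indicator_of_mem hη,
    ENNReal.mul_div_mul_left _ _ (D.tilt_mul_betaWeight_ne_zero η)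
      (D.tilt_mul_betaWeight_ne_top η)]
  simp only [div_eq_mul_inv]
  rw [ENNReal.mul_inv (Or.inl (D.condTauConst_ne_zero hτ η)) (Or.inr (D.prod_height_ne_zero η))]
  ring

theorem transDensity_eq (hτ : 0 < D.τ₀) (hcov : D.cov.PosDef)
    (hξ : ∀ i, ConvexOn ℝ Set.univ (D.ξ i)) {η' : Coef p m} (hη' : η' ∈ D.feasible)
    (η : Coef p m) :
    D.transDensity η' η = augDensity volume volume D.augWeight η' η := by
  have hm := D.measurable_augWeight hξ
  have hm1 : ∀ η, Measurable (D.augWeight η) := fun η => hm.of_uncurry_left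
  have hm2 : Measurable fun y => ∫⁻ z, D.augWeight z y := hm.lintegral_prod_left'
  have hmeas : Measurable fun y => D.augWeight η y / (∫⁻ z, D.augWeight z y) *
      (D.augWeight η' y / ∫⁻ y, D.augWeight η' y) :=
    ((hm1 η).div hm2).mul ((hm1 η').div_const _)
  unfold transDensity augDensity
  refine Eq.trans ?_ (lintegral_prod _ hmeas.aemeasurable).symm
  refine lintegral_congr fun τ => lintegral_congr fun ω => ?_
  rw [D.omegaPDF_mul_tauPDF hτ hη' (τ, ω)]
  by_cases h : (Set.Ici 0).indicator 1 ω * D.tauWeight τ = 0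
  · have : D.augWeight η' (τ, ω) = 0 := by simp only [augWeight, h, mul_zero]
    simp [this]
  · obtain ⟨h₁, h₂⟩ := D.le_of_tauWeight_ne_zero (right_ne_zero_of_mul h)
    have hω : ω ∈ Set.Ici 0 := by
      by_contra h'
      exact left_ne_zero_of_mul h (Set.indicator_of_notMem h' _)
    have ht : (Set.Ici 0).indicator 1 ω * D.tauWeight τ ≠ ∞ := by
      rw [Set.indicator_of_mem hω, Pi.one_apply, one_mul]
      exact D.tauWeight_ne_top τ
    congr 1
    rw [D.etaPDF_eq hcov (hτ.trans_le h₁) (hτ.trans_le h₂), lintegral_augWeight_left D hξ,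
      augWeight, ENNReal.mul_div_mul_right _ _ h ht]

/-! ### The posterior -/

/-- The prior normalizing constants of `η` and of `τ` enter the posterior as a constant factor
only, and the posterior weight of `η` is the marginal of the joint density of `(η, τ, ω)`. -/
theorem exists_marginalWeight_eq (ha : 0 < D.a₀) (hb : 0 < D.b₀) (hτ : 0 < D.τ₀)
    (hcov : D.cov.PosDef) (hfeas : 0 < volume D.feasibleBeta) :
    ∃ κ : ℝ≥0∞, κ ≠ 0 ∧ κ ≠ ∞ ∧ ∀ η, D.marginalWeight η = κ * ∫⁻ y, D.augWeight η y := by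
  set Z := ∫⁻ η in D.feasible, D.gauss (1, 1) η with hZ
  set C := truncGammaConst D.a₀ D.b₀ D.τ₀
  have hC0 : C ≠ 0 := truncGammaConst_ne_zero hτ
  have hCt : C ≠ ∞ := truncGammaConst_ne_top ha hb hτ
  have hZt : Z ≠ ∞ := ne_top_of_le_ne_top
    (D.lintegral_gauss_ne_top hcov (τ := (1, 1)) one_pos one_pos) (setLIntegral_le_lintegral _ _)
  have hZ0 : Z ≠ 0 := by
    rw [hZ, Ne, lintegral_eq_zero_iff (D.measurable_gauss_right _)]
    intro h0
    rw [Filter.EventuallyEq, ae_restrict_iff' D.isClosed_feasible.measurableSet] at h0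
    refine D.volume_feasible_ne_zero hfeas (measure_mono_null (fun z hz => ?_) (ae_iff.1 h0))
    simp only [Set.mem_ofPred_eq, Classical.not_imp]
    exact ⟨hz, D.gauss_ne_zero _ z⟩
  refine ⟨(Z * (C * C))⁻¹, by simp [ENNReal.mul_eq_top, hZt, hCt, hZ0, hC0], by simp [hZ0, hC0],
    fun η => ?_⟩
  have hjoint : ∀ τ, D.jointWeight η τ = (Z * (C * C))⁻¹ *
      (D.feasible.indicator (fun η => D.likelihood η * D.betaWeight η) η *
        D.condTauWeight η τ) := by
    intro τ
    unfold jointWeight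
    rw [truncGammaPDF_eq, truncGammaPDF_eq]
    by_cases h : D.τ₀ ≤ τ.1 ∧ D.τ₀ ≤ τ.2
    · have h₁ := hτ.trans_le h.1
      have h₂ := hτ.trans_le h.2
      set s := ((m : ℝ) + 2) / 2
      have hs₁ : ENNReal.ofReal (τ.1 ^ s) ≠ 0 :=
        (ENNReal.ofReal_pos.2 (Real.rpow_pos_of_pos h₁ _)).ne'
      have hs₂ : ENNReal.ofReal (τ.2 ^ s) ≠ 0 :=
        (ENNReal.ofReal_pos.2 (Real.rpow_pos_of_pos h₂ _)).ne'
      set P := ENNReal.ofReal (τ.1 ^ s) * ENNReal.ofReal (τ.2 ^ s) with hP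
      have hP0 : P ≠ 0 := mul_ne_zero hs₁ hs₂
      have hPt : P ≠ ∞ := ENNReal.mul_ne_top ENNReal.ofReal_ne_top ENNReal.ofReal_ne_top
      have hnorm : ∀ x, x / (∫⁻ z in D.feasible, D.gauss τ z) = P * x / Z := by
        intro x
        rw [hZ, ← D.setLIntegral_gauss h₁ h₂, ENNReal.mul_div_mul_left _ _ hP0 hPt]
      unfold truncNormalPDF
      by_cases hη : η ∈ D.feasible
      · simp only [hη, Set.indicator_of_mem]
        have hg := D.gauss_mul_tauWeight η τ
        unfold tauWeight at hg
        rw [← gammaWeight_mul_rpow hτ, ← gammaWeight_mul_rpow hτ] at hg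
        calc _ = D.likelihood η * (P * D.gauss τ η / Z) *
              (gammaWeight D.a₀ D.b₀ D.τ₀ τ.1 / C * (gammaWeight D.a₀ D.b₀ D.τ₀ τ.2 / C)) := by
              rw [← hnorm]; rfl
          _ = (Z⁻¹ * (C⁻¹ * C⁻¹)) * (D.likelihood η * (D.gauss τ η *
              (gammaWeight D.a₀ D.b₀ D.τ₀ τ.1 * ENNReal.ofReal (τ.1 ^ s) *
                (gammaWeight D.a₀ D.b₀ D.τ₀ τ.2 * ENNReal.ofReal (τ.2 ^ s))))) := by
              rw [hP]; simp only [div_eq_mul_inv]; ring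
          _ = _ := by
              rw [hg, ENNReal.mul_inv (Or.inl hZ0) (Or.inl hZt), ENNReal.mul_inv (Or.inl hC0)
                (Or.inl hCt)]
              ring
      · simp [hη]
    · rw [not_and_or, not_le, not_le] at h
      rcases h with h | h <;> simp [condTauWeight, gammaWeight_of_lt h]
  unfold marginalWeight
  simp only [hjoint]
  have hm := D.measurable_condTauWeight η
  rw [lintegral_const_mul _ (hm.const_mul _), lintegral_const_mul _ hm, lintegral_condTauWeight,
    lintegral_augWeight]
  congr 1
  by_cases hη : η ∈ D.feasible
  · simp only [hη, Set.indicator_of_mem, likelihood_eq]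
    ring
  · simp [hη]

theorem height_le_one (hξ₀ : ∀ i, ∀ η : Coef p m, 0 ≤ D.ξ i (D.linPred i η)) (i : Fin N)
    (η : Coef p m) : D.height i η ≤ 1 := by
  unfold height
  rw [Real.exp_le_one_iff]
  linarith [hξ₀ i η]

/-- The posterior weight is integrable: the likelihood is at most the tilt `exp(yᵀ M η)`, and
integrating out `τ ≥ τ₀` leaves Gaussian decay in every direction. -/
theorem lintegral_lintegral_augWeight_ne_top (ha : 0 < D.a₀) (hb : 0 < D.b₀) (hτ : 0 < D.τ₀)
    (hcov : D.cov.PosDef) (hξ₀ : ∀ i, ∀ η : Coef p m, 0 ≤ D.ξ i (D.linPred i η)) :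
    ∫⁻ η, ∫⁻ y, D.augWeight η y ≠ ∞ := by
  set C := truncGammaConst (D.a₀ + ((m : ℝ) + 2) / 2) D.b₀ D.τ₀
  have hCt : C ≠ ∞ := truncGammaConst_ne_top (by positivity) hb hτ
  have hbound : ∀ η, ∫⁻ y, D.augWeight η y
      ≤ C * C * (D.tilt η * D.gauss (D.τ₀, D.τ₀) η) := by
    intro η
    rw [lintegral_augWeight]
    have h1 : D.feasible.indicator (fun η => D.tilt η * D.betaWeight η) η
        ≤ D.tilt η * D.betaWeight η := Set.indicator_le_self _ _ η
    have h2 : ∏ i, ENNReal.ofReal (D.height i η) ≤ 1 :=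
      Finset.prod_le_one' fun i _ => ENNReal.ofReal_le_one.2 (D.height_le_one hξ₀ i η)
    have h3 := truncGammaConst_add_le (D.a₀ + ((m : ℝ) + 2) / 2) D.b₀ D.τ₀
      (dotProduct_self_half_nonneg η.uA)
    have h4 := truncGammaConst_add_le (D.a₀ + ((m : ℝ) + 2) / 2) D.b₀ D.τ₀
      (dotProduct_self_half_nonneg η.uB)
    calc _ ≤ D.tilt η * D.betaWeight η *
          ((C * ENNReal.ofReal (Real.exp (-((η.uA ⬝ᵥ η.uA) / 2 * D.τ₀)))) *
            (C * ENNReal.ofReal (Real.exp (-((η.uB ⬝ᵥ η.uB) / 2 * D.τ₀)))) * 1) := by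
          unfold condTauConst
          gcongr
      _ = _ := by rw [gauss_eq]; ring
  refine ne_top_of_le_ne_top ?_ (lintegral_mono hbound)
  rw [lintegral_const_mul _ (D.measurable_tilt_mul_gauss _)]
  exact ENNReal.mul_ne_top (ENNReal.mul_ne_top hCt hCt)
    (D.lintegral_tilt_mul_gauss_ne_top hcov hτ hτ)

theorem lintegral_lintegral_augWeight_ne_zero (hτ : 0 < D.τ₀)
    (hfeas : 0 < volume D.feasibleBeta) (hξ : ∀ i, ConvexOn ℝ Set.univ (D.ξ i)) :
    ∫⁻ η, ∫⁻ y, D.augWeight η y ≠ 0 := by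
  have hm : Measurable fun η => ∫⁻ y, D.augWeight η y :=
    (D.measurable_augWeight hξ).lintegral_prod_right'
  rw [Ne, lintegral_eq_zero_iff hm]
  exact fun h0 => D.volume_feasible_ne_zero hfeas
    (measure_mono_null (fun z hz => D.lintegral_augWeight_ne_zero hτ hz) (ae_iff.1 h0))

theorem posterior_eq (ha : 0 < D.a₀) (hb : 0 < D.b₀) (hτ : 0 < D.τ₀)
    (hcov : D.cov.PosDef) (hfeas : 0 < volume D.feasibleBeta)
    (hξ : ∀ i, ConvexOn ℝ Set.univ (D.ξ i)) :
    D.posterior = volume.withDensity fun η =>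
      (∫⁻ y, D.augWeight η y) / ∫⁻ η, ∫⁻ y, D.augWeight η y := by
  obtain ⟨κ, hκ0, hκt, hκ⟩ := D.exists_marginalWeight_eq ha hb hτ hcov hfeas
  have hm : Measurable fun η => ∫⁻ y, D.augWeight η y :=
    (D.measurable_augWeight hξ).lintegral_prod_right'
  unfold posterior
  simp only [hκ]
  rw [lintegral_const_mul _ hm]
  simp only [ENNReal.mul_div_mul_left _ _ hκ0 hκt]

/-! ### The minorization -/

/-- From every state the slice variables fall below the heights of `η` with probability at least
the product of these heights. -/
theorem prod_height_le_lintegral_omegaPDF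
    (hξ₀ : ∀ i, ∀ η : Coef p m, 0 ≤ D.ξ i (D.linPred i η)) (η' η : Coef p m) :
    ∏ i, ENNReal.ofReal (D.height i η) ≤ ∫⁻ ω in D.box η, D.omegaPDF η' ω := by
  set c := ∏ i, ENNReal.ofReal (D.height i η') with hc
  -- As both heights are at most `1`, the box whose sides are their products lies in both boxes.
  set S : Set (Fin N → ℝ) := Set.Icc 0 fun i => D.height i η * D.height i η'
  have hS : S ⊆ D.box η := Set.Icc_subset_Icc_right fun i =>
    mul_le_of_le_one_right (D.height_pos i η).le (D.height_le_one hξ₀ i η')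
  have hS' : S ⊆ D.box η' := Set.Icc_subset_Icc_right fun i =>
    mul_le_of_le_one_left (D.height_pos i η').le (D.height_le_one hξ₀ i η)
  have hvol : volume S = (∏ i, ENNReal.ofReal (D.height i η)) * c := by
    rw [Real.volume_Icc_pi, hc, ← Finset.prod_mul_distrib]
    refine Finset.prod_congr rfl fun i _ => ?_
    rw [Pi.zero_apply, sub_zero, ENNReal.ofReal_mul (D.height_pos i η).le]
  calc ∏ i, ENNReal.ofReal (D.height i η)
      = ∫⁻ _ in S, c⁻¹ := by
        rw [setLIntegral_const, hvol, mul_comm, mul_assoc,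
          ENNReal.mul_inv_cancel (D.prod_height_ne_zero η') (D.prod_height_ne_top η'), mul_one]
    _ ≤ ∫⁻ ω in S, D.omegaPDF η' ω := by
        refine setLIntegral_mono' measurableSet_Icc fun ω hω => ?_
        rw [omegaPDF_eq, Set.indicator_of_mem (hS' hω), Pi.one_apply, one_div]
    _ ≤ _ := lintegral_mono_set hS

/-- The precisions stay below `τ₀ + 1` with a probability bounded below over all states. -/
theorem exists_le_setLIntegral_tauPDF (ha : 0 < D.a₀) (hb : 0 < D.b₀) (hτ : 0 < D.τ₀) :
    ∃ c : ℝ≥0∞, c ≠ 0 ∧ ∀ η : Coef p m,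
      c ≤ ∫⁻ τ in Set.Iic (D.τ₀ + 1) ×ˢ Set.Iic (D.τ₀ + 1), D.tauPDF η τ := by
  obtain ⟨c, hc0, hc⟩ := exists_le_setLIntegral_truncGammaPDF
    (a := D.a₀ + ((m : ℝ) + 2) / 2) (b := D.b₀) (by positivity) hb hτ
  refine ⟨c * c, mul_ne_zero hc0 hc0, fun η => ?_⟩
  unfold tauPDF
  rw [Measure.volume_eq_prod, ← Measure.prod_restrict,
    lintegral_prod_mul (measurable_truncGammaPDF _ _ _).aemeasurable
      (measurable_truncGammaPDF _ _ _).aemeasurable]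
  exact mul_le_mul' (hc _ (dotProduct_self_half_nonneg _)) (hc _ (dotProduct_self_half_nonneg _))

/-- The weight that the transition density dominates, up to a constant, from every state: the
prior density of `η` at precisions `τ₀ + 1`, times the likelihood. -/
noncomputable def minorant (η : Coef p m) : ℝ≥0∞ :=
  D.feasible.indicator
    (fun η => D.tilt η * D.gauss (D.τ₀ + 1, D.τ₀ + 1) η * ∏ i, ENNReal.ofReal (D.height i η)) η

theorem measurable_minorant (hξ : ∀ i, ConvexOn ℝ Set.univ (D.ξ i)) : Measurable D.minorant := by
  refine Measurable.indicator ((D.measurable_tilt_mul_gauss _).mul ?_)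
    D.isClosed_feasible.measurableSet
  exact Finset.measurable_prod _ fun i _ => (D.continuous_height hξ i).measurable.ennreal_ofReal

theorem lintegral_minorant_ne_zero (hfeas : 0 < volume D.feasibleBeta)
    (hξ : ∀ i, ConvexOn ℝ Set.univ (D.ξ i)) : ∫⁻ η, D.minorant η ≠ 0 := by
  rw [Ne, lintegral_eq_zero_iff (D.measurable_minorant hξ)]
  refine fun h0 => D.volume_feasible_ne_zero hfeas
    (measure_mono_null (fun z hz => ?_) (ae_iff.1 h0))
  unfold minorant
  simp only [Set.mem_ofPred_eq, Set.indicator_of_mem hz]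
  exact mul_ne_zero (mul_ne_zero (D.tilt_ne_zero z) (D.gauss_ne_zero _ z)) (D.prod_height_ne_zero z)

theorem exists_mul_minorant_le_transDensity (ha : 0 < D.a₀) (hb : 0 < D.b₀) (hτ : 0 < D.τ₀)
    (hcov : D.cov.PosDef) (hξ₀ : ∀ i, ∀ η : Coef p m, 0 ≤ D.ξ i (D.linPred i η)) :
    ∃ c : ℝ≥0∞, c ≠ 0 ∧ ∀ η' η, c * D.minorant η ≤ D.transDensity η' η := by
  obtain ⟨c, hc0, hc⟩ := D.exists_le_setLIntegral_tauPDF ha hb hτ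
  set B := ∫⁻ η, D.tilt η * D.gauss (D.τ₀, D.τ₀) η
  have hBt : B ≠ ∞ := D.lintegral_tilt_mul_gauss_ne_top hcov hτ hτ
  refine ⟨c / B, (ENNReal.div_pos hc0 hBt).ne', fun η' η => ?_⟩
  unfold minorant
  by_cases hη : η ∈ D.feasible
  swap
  · simp [hη]
  rw [Set.indicator_of_mem hη]
  set T := D.τ₀ + 1
  set g := D.tilt η * D.gauss (T, T) η
  set Q : Set (ℝ × ℝ) := Set.Iic T ×ˢ Set.Iic T
  have hQ : MeasurableSet Q := measurableSet_Iic.prod measurableSet_Iic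
  have hpoint : ∀ τ ∈ Q, ∀ ω ∈ D.box η,
      g / B * (D.omegaPDF η' ω * D.tauPDF η' τ)
        ≤ D.etaPDF ω τ η * (D.omegaPDF η' ω * D.tauPDF η' τ) := by
    intro τ hτQ ω hω
    by_cases h : D.τ₀ ≤ τ.1 ∧ D.τ₀ ≤ τ.2
    · obtain ⟨h₁, h₂⟩ := h
      have hmem : η ∈ D.sliceSet ω := ⟨hη, fun i => hω.2 i⟩
      refine mul_le_mul' ?_ le_rfl
      rw [D.etaPDF_eq hcov (hτ.trans_le h₁) (hτ.trans_le h₂), Set.indicator_of_mem hmem]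
      refine ENNReal.div_le_div (mul_le_mul' le_rfl (D.gauss_anti η hτQ.1 hτQ.2)) ?_
      refine (setLIntegral_le_lintegral _ _).trans (lintegral_mono fun z => ?_)
      exact mul_le_mul' le_rfl (D.gauss_anti z h₁ h₂)
    · have h0 : D.tauPDF η' τ = 0 := by
        rw [D.tauPDF_eq hτ]
        rw [not_and_or, not_le, not_le] at h
        rcases h with h | h <;> simp [condTauWeight, gammaWeight_of_lt h]
      simp [h0]
  have hmω : Measurable (D.omegaPDF η') := by
    have : D.omegaPDF η' = fun ω => _ := funext fun ω => D.omegaPDF_eq η' ω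
    rw [this]
    exact (measurable_one.indicator (D.measurableSet_box η')).div_const _
  have hmτ : Measurable (D.tauPDF η') :=
    ((measurable_truncGammaPDF _ _ _).comp measurable_fst).mul
      ((measurable_truncGammaPDF _ _ _).comp measurable_snd)
  calc c / B * (g * ∏ i, ENNReal.ofReal (D.height i η))
      = g / B * (c * ∏ i, ENNReal.ofReal (D.height i η)) := by
        simp only [div_eq_mul_inv]; ring
    _ ≤ g / B * ((∫⁻ τ in Q, D.tauPDF η' τ) * ∫⁻ ω in D.box η, D.omegaPDF η' ω) :=
        mul_le_mul' le_rfl (mul_le_mul' (hc η') (D.prod_height_le_lintegral_omegaPDF hξ₀ η' η))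
    _ = ∫⁻ τ in Q, ∫⁻ ω in D.box η, g / B * (D.omegaPDF η' ω * D.tauPDF η' τ) := by
        have : ∀ τ, ∫⁻ ω in D.box η, g / B * (D.omegaPDF η' ω * D.tauPDF η' τ)
            = D.tauPDF η' τ * (g / B * ∫⁻ ω in D.box η, D.omegaPDF η' ω) := by
          intro τ
          rw [lintegral_const_mul _ (hmω.mul_const _), lintegral_mul_const _ hmω]
          ring
        simp only [this]
        rw [lintegral_mul_const _ hmτ]
        ring
    _ ≤ ∫⁻ τ in Q, ∫⁻ ω in D.box η, D.etaPDF ω τ η * (D.omegaPDF η' ω * D.tauPDF η' τ) :=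
        setLIntegral_mono' hQ fun τ hτQ =>
          setLIntegral_mono' (D.measurableSet_box η) fun ω hω => hpoint τ hτQ ω hω
    _ ≤ ∫⁻ τ in Q, ∫⁻ ω, D.etaPDF ω τ η * (D.omegaPDF η' ω * D.tauPDF η' τ) :=
        lintegral_mono fun τ => setLIntegral_le_lintegral _ _
    _ ≤ _ := setLIntegral_le_lintegral _ _

/-! ### Ergodicity of the sampler -/

/-- The transition function given by the joint density; it agrees with `Model.trans` on the
constraint set and depends measurably on the state everywhere. -/
noncomputable def augTrans (η : Coef p m) : Measure (Coef p m) :=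
  volume.withDensity (augDensity volume volume D.augWeight η)

theorem trans_eq (hτ : 0 < D.τ₀) (hcov : D.cov.PosDef) (hξ : ∀ i, ConvexOn ℝ Set.univ (D.ξ i)) :
    ∀ η ∈ D.feasible, D.trans η = D.augTrans η := by
  intro η hη
  unfold trans augTrans
  congr 1
  exact funext fun z => D.transDensity_eq hτ hcov hξ hη z

theorem isMarkovOn_trans (ha : 0 < D.a₀) (hb : 0 < D.b₀) (hτ : 0 < D.τ₀) (hcov : D.cov.PosDef)
    (hfeas : 0 < volume D.feasibleBeta) (hξ : ∀ i, ConvexOn ℝ Set.univ (D.ξ i)) :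
    IsMarkovOn D.feasible D.trans := by
  intro η hη
  have hm := D.measurable_augWeight hξ
  rw [D.trans_eq hτ hcov hξ η hη, augTrans]
  refine ⟨⟨?_⟩, ?_⟩
  · rw [withDensity_apply _ MeasurableSet.univ, setLIntegral_univ]
    exact lintegral_augDensity hm (D.lintegral_augWeight_ne_top ha hb hτ)
      (D.lintegral_augWeight_left_ne_top hτ hcov hξ)
      (D.ae_lintegral_augWeight_left_ne_zero hfeas hξ) (D.lintegral_augWeight_ne_zero hτ hη)
  · have hC := D.isClosed_feasible.measurableSet.compl
    rw [withDensity_apply _ hC]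
    refine (setLIntegral_congr_fun hC fun z hz => ?_).trans lintegral_zero
    have h0 : ∀ y, D.augWeight z y = 0 := fun y => by
      rw [augWeight_eq, Set.indicator_of_notMem hz, zero_mul]
    simp [augDensity, h0]

theorem isProbabilityMeasure_posterior (ha : 0 < D.a₀) (hb : 0 < D.b₀) (hτ : 0 < D.τ₀)
    (hcov : D.cov.PosDef) (hfeas : 0 < volume D.feasibleBeta)
    (hξ₀ : ∀ i, ∀ η : Coef p m, 0 ≤ D.ξ i (D.linPred i η))
    (hξ : ∀ i, ConvexOn ℝ Set.univ (D.ξ i)) : IsProbabilityMeasure D.posterior := by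
  have hm : Measurable fun η => ∫⁻ y, D.augWeight η y :=
    (D.measurable_augWeight hξ).lintegral_prod_right'
  refine ⟨?_⟩
  rw [D.posterior_eq ha hb hτ hcov hfeas hξ, withDensity_apply _ MeasurableSet.univ,
    setLIntegral_univ]
  simp only [div_eq_mul_inv]
  rw [lintegral_mul_const _ hm]
  exact ENNReal.mul_inv_cancel (D.lintegral_lintegral_augWeight_ne_zero hτ hfeas hξ)
    (D.lintegral_lintegral_augWeight_ne_top ha hb hτ hcov hξ₀)

theorem posterior_compl_feasible (ha : 0 < D.a₀) (hb : 0 < D.b₀) (hτ : 0 < D.τ₀)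
    (hcov : D.cov.PosDef) (hfeas : 0 < volume D.feasibleBeta)
    (hξ : ∀ i, ConvexOn ℝ Set.univ (D.ξ i)) : D.posterior D.feasibleᶜ = 0 := by
  have hC := D.isClosed_feasible.measurableSet.compl
  rw [D.posterior_eq ha hb hτ hcov hfeas hξ, withDensity_apply _ hC]
  refine (setLIntegral_congr_fun hC fun z hz => ?_).trans lintegral_zero
  rw [lintegral_augWeight, Set.indicator_of_notMem hz, zero_mul, ENNReal.zero_div]

theorem lintegral_stepProb_posterior (ha : 0 < D.a₀) (hb : 0 < D.b₀) (hτ : 0 < D.τ₀)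
    (hcov : D.cov.PosDef) (hfeas : 0 < volume D.feasibleBeta)
    (hξ : ∀ i, ConvexOn ℝ Set.univ (D.ξ i)) {A : Set (Coef p m)} (hA : MeasurableSet A) (n : ℕ) :
    ∫⁻ η, stepProb D.trans n η A ∂D.posterior = D.posterior A := by
  have hcongr := stepProb_congr (D.trans_eq hτ hcov hξ)
    (fun η hη => (D.isMarkovOn_trans ha hb hτ hcov hfeas hξ η hη).2) A n
  have hae : ∀ᵐ η ∂D.posterior, η ∈ D.feasible :=
    D.posterior_compl_feasible ha hb hτ hcov hfeas hξ
  rw [lintegral_congr_ae (by filter_upwards [hae] with η hη using hcongr η hη),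
    D.posterior_eq ha hb hτ hcov hfeas hξ]
  exact lintegral_stepProb_augDensity (D.measurable_augWeight hξ)
    (D.lintegral_augWeight_ne_top ha hb hτ) (D.lintegral_augWeight_left_ne_top hτ hcov hξ)
    (D.ae_lintegral_augWeight_left_ne_zero hfeas hξ) _ hA n

theorem exists_minorization (ha : 0 < D.a₀) (hb : 0 < D.b₀) (hτ : 0 < D.τ₀)
    (hcov : D.cov.PosDef) (hfeas : 0 < volume D.feasibleBeta)
    (hξ₀ : ∀ i, ∀ η : Coef p m, 0 ≤ D.ξ i (D.linPred i η))
    (hξ : ∀ i, ConvexOn ℝ Set.univ (D.ξ i)) :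
    ∃ (δ : ℝ) (h : Coef p m → ℝ≥0∞),
      0 < δ ∧ Measurable h ∧ ∫⁻ η, h η = 1 ∧
      ∀ η' ∈ D.feasible, ∀ η, ENNReal.ofReal δ * h η ≤ D.transDensity η' η := by
  obtain ⟨c, hc0, hc⟩ := D.exists_mul_minorant_le_transDensity ha hb hτ hcov hξ₀
  have hm : Measurable D.minorant := D.measurable_minorant hξ
  set I := ∫⁻ η, c * D.minorant η with hI
  have hI0 : I ≠ 0 := by
    rw [hI, lintegral_const_mul _ hm]
    exact mul_ne_zero hc0 (D.lintegral_minorant_ne_zero hfeas hξ)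
  -- The integral is at most that of a transition density, which is `1`.
  have hI1 : I ≤ 1 := by
    obtain ⟨η', hη'⟩ := (D.interior_feasible_nonempty hfeas).mono interior_subset
    have h := (D.isMarkovOn_trans ha hb hτ hcov hfeas hξ η' hη').1.measure_univ
    rw [trans, withDensity_apply _ MeasurableSet.univ, setLIntegral_univ] at h
    exact (lintegral_mono (hc η')).trans h.le
  have hIt : I ≠ ∞ := ne_top_of_le_ne_top ENNReal.one_ne_top hI1
  refine ⟨I.toReal, fun η => c * D.minorant η / I, ENNReal.toReal_pos hI0 hIt,
    (hm.const_mul c).div_const I, ?_, fun η' _ η => ?_⟩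
  · simp only [div_eq_mul_inv]
    rw [lintegral_mul_const _ (hm.const_mul c)]
    exact ENNReal.mul_inv_cancel hI0 hIt
  · rw [ENNReal.ofReal_toReal hIt, ENNReal.mul_div_cancel hI0 hIt]
    exact hc η' η

end Model

end SliceGibbs

theorem theorem1 {N p m q : ℕ} (D : SliceGibbs.Model N p m q)
    (ha : 0 < D.a₀) (hb : 0 < D.b₀) (hτ : 0 < D.τ₀) (hcov : D.cov.PosDef)
    (hfeas : 0 < volume D.feasibleBeta)
    (hξ_nonneg : ∀ i, ∀ η : SliceGibbs.Coef p m, 0 ≤ D.ξ i (D.linPred i η))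
    (hξ_convex : ∀ i, ConvexOn ℝ Set.univ (D.ξ i)) :
    IsProbabilityMeasure D.posterior ∧
    SliceGibbs.IsMarkovOn D.feasible D.trans ∧
    (∃ (δ : ℝ) (h : SliceGibbs.Coef p m → ℝ≥0∞),
      0 < δ ∧ Measurable h ∧ ∫⁻ η, h η = 1 ∧
      ∀ η' ∈ D.feasible, ∀ η, ENNReal.ofReal δ * h η ≤ D.transDensity η' η) ∧
    SliceGibbs.IsUniformlyErgodic D.feasible D.trans D.posterior := by
  have hP := D.isProbabilityMeasure_posterior ha hb hτ hcov hfeas hξ_nonneg hξ_convex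
  have hK := D.isMarkovOn_trans ha hb hτ hcov hfeas hξ_convex
  have hmin := D.exists_minorization ha hb hτ hcov hfeas hξ_nonneg hξ_convex
  refine ⟨hP, hK, hmin, ?_⟩
  obtain ⟨δ, h, hδ, hh, hh1, hle⟩ := hmin
  have hν : IsProbabilityMeasure (volume.withDensity h) :=
    ⟨by rw [withDensity_apply _ MeasurableSet.univ, setLIntegral_univ, hh1]⟩
  -- The constant is lowered below `1`, so that the rate `1 - δ` is positive.
  refine SliceGibbs.isUniformlyErgodic_of_minorization hK (δ := min δ (1 / 2))
    (lt_min hδ one_half_pos) ((min_le_right _ _).trans_lt one_half_lt_one)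
    (ν := volume.withDensity h) (fun η hη => ?_)
    (D.posterior_compl_feasible ha hb hτ hcov hfeas hξ_convex)
    (fun A hA n => D.lintegral_stepProb_posterior ha hb hτ hcov hfeas hξ_convex hA n)
  rw [← withDensity_smul _ hh]
  refine withDensity_mono (Filter.Eventually.of_forall fun z => ?_)
  refine le_trans ?_ (hle η hη z)
  exact mul_le_mul' (ENNReal.ofReal_le_ofReal (min_le_left _ _)) le_rfl
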